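/- Let $(X,\mathcal A,m)$ be a $\sigma$-finite measure space and let $\mathcal E$, with domain $\mathcal D\subset L^2=L^2(X,m)$ (real-valued functions), be a symmetric Dirichlet form, i.e. a densely defined closed nonnegative symmetric quadratic form such that $u\in\mathcal D$ implies $u_{0,1}:=\min(\max(u,0),1)\in\mathcal D$ and $\mathcal E[u_{0,1}]\le\mathcal E[u]$. Let $K_\beta$ ($\beta>0$) and $T_t$ ($t>0$) be the resolvent and the semigroup of $\mathcal E$ on $L^2$, and consider the bounded forms with domain $L^2$ $$\mathcal E^{(t)}[u]=\tfrac1t\,(u-T_tu,u)\quad(\text{time-dependent approximation}),\qquad \mathcal E^{(\beta)}[u]=\beta\,(u-\beta K_\beta u,u)\quad(\text{Deny--Yosida approximation}).$$ For each of the forms $\mathcal F\in\{\mathcal E,\mathcal E^{(t)},\mathcal E^{(\beta)}\}$, with semigroup $(T^{\mathcal F}_s)_{s>0}$, let $T^{\mathcal F}_s1$ be the a.e. limit of $T^{\mathcal F}_s\varphi_k$, where $\varphi_k\in L^1\cap L^\infty$, $0<\varphi_k\le 1$, $\varphi_k\uparrow1$ a.e. The form $\mathcal F$ is called conservative if $T^{\mathcal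 F}_s1=1$ a.e. for every $s>0$, and dissipative if $m(\{T^{\mathcal F}_s1<1\})>0$ for some $s>0$. The conservative space of $\mathcal F$ is $X_{\mathrm{cons}}(\mathcal F)=\bigcap_{s>0}\{T^{\mathcal F}_s1=1\}$, the intersection being understood up to $m$-null sets (the largest measurable set, up to null sets, on which $T^{\mathcal F}_s1=1$ a.e. for every $s>0$), and the dissipative space is $X_{\mathrm{diss}}(\mathcal F)=X\setminus X_{\mathrm{cons}}(\mathcal F)$. **Theorem.** These spaces exist and: (a) For all $t,\beta>0$, up to $m$-null sets, $$X_{\mathrm{cons}}(\mathcal E)=X_{\mathrm{cons}}(\mathcal E^{(t)})=X_{\mathrm{cons}}(\mathcal E^{(\beta)}),\qquad X_{\mathrm{diss}}(\mathcal E)=X_{\mathrm{diss}}(\mathcal E^{(t)})=X_{\mathrm{diss}}(\mathcal E^{(\beta)}).$$ (b) The following are equivalent: $\mathcal E$ is conservative; $\mathcal E^{(t)}$ is conservative for some $t>0$; $\mathcal E^{(t)}$ is conservative for every $t>0$; $\mathcal E^{(\beta)}$ is conservative for some $\beta>0$; $\mathcal E^{(\beta)}$ is conservative for every $\beta>0$.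 The same equivalences hold with "dissipative" in place of "conservative". -/

import Mathlib

open MeasureTheory Filter Topology
open scoped ENNReal NNReal

noncomputable section

namespace DirichletForms

variable {X : Type*} [MeasurableSpace X]

/-- A bilinear form `E(u,v)` defined on a linear subspace `dom` of the real Hilbert space
`L²(X,m)`. The associated quadratic form is `E[u] = E(u,u)`. -/
structure FormOn (m : Measure X) where
  dom : Submodule ℝ (Lp ℝ 2 m)
  form : LinearMap.BilinForm ℝ dom

/-- The normal contraction `u ↦ min (max u 0) 1` on `L²(X,m)`. -/
def unitContraction {m : Measure X} (u : Lp ℝ 2 m) : Lp ℝ 2 m :=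
  LipschitzWith.compLp (g := fun s : ℝ => min (max s 0) 1) (c := 1)
    ((LipschitzWith.id.max_const 0).min_const 1) (by simp) u

theorem coeFn_unitContraction {m : Measure X} (u : Lp ℝ 2 m) :
    unitContraction u =ᵐ[m] fun x => min (max (u x) 0) 1 :=
  LipschitzWith.coeFn_compLp _ _ u

/-- Symmetric Dirichlet forms in `L²(X,m)`: symmetric, nonnegative, densely defined, closed
(the domain is complete for the norm `(E[u] + ‖u‖²)^(1/2)`) and Markovian. -/
structure FormOn.IsDirichletForm {m : Measure X} (E : FormOn m) : Prop where
  symm : ∀ u v : E.dom, E.form u v = E.form v u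
  nonneg : ∀ u : E.dom, 0 ≤ E.form u u
  dense : Dense (E.dom : Set (Lp ℝ 2 m))
  closed : ∀ u : ℕ → E.dom,
    (∀ ε > 0, ∃ N, ∀ j ≥ N, ∀ k ≥ N,
      E.form (u j - u k) (u j - u k) + ‖(u j : Lp ℝ 2 m) - (u k : Lp ℝ 2 m)‖ ^ 2 < ε) →
    ∃ w : E.dom, Tendsto
      (fun j => E.form (u j - w) (u j - w) + ‖(u j : Lp ℝ 2 m) - (w : Lp ℝ 2 m)‖ ^ 2)
      atTop (𝓝 0)
  markov : ∀ u : E.dom, ∃ h : unitContraction (u : Lp ℝ 2 m) ∈ E.dom,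
    E.form ⟨unitContraction (u : Lp ℝ 2 m), h⟩ ⟨unitContraction (u : Lp ℝ 2 m), h⟩ ≤ E.form u u

/-- `K` is the resolvent operator `K_β` of `E`: for `f ∈ L²`, `K f` lies in the domain of `E` and
`E(K f, v) + β (K f, v) = (f, v)` for all `v` in the domain. -/
def FormOn.IsResolvent {m : Measure X} (E : FormOn m) (β : ℝ)
    (K : Lp ℝ 2 m →L[ℝ] Lp ℝ 2 m) : Prop :=
  ∀ f : Lp ℝ 2 m, ∃ h : K f ∈ E.dom, ∀ v : E.dom,
    E.form ⟨K f, h⟩ v + β * inner ℝ (K f) (v : Lp ℝ 2 m) = inner ℝ f (v : Lp ℝ 2 m)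

open Classical in
/-- The resolvent `K_β`, `β > 0`, of a closed form (it exists by the Riesz representation theorem
and is unique). -/
def FormOn.resolvent {m : Measure X} (E : FormOn m) (β : ℝ) : Lp ℝ 2 m →L[ℝ] Lp ℝ 2 m :=
  if h : ∃ K, E.IsResolvent β K then h.choose else 0

/-- `S` is the operator `T_t` of the semigroup of `E`, i.e. the strong limit, as `β → ∞`, of
`exp (-t β (1 - β K_β))`; this is `exp (-t L)` for the nonnegative selfadjoint operator `L`
associated with `E`. -/
def FormOn.IsSemigroupOperator {m : Measure X} (E : FormOn m) (t : ℝ)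
    (S : Lp ℝ 2 m →L[ℝ] Lp ℝ 2 m) : Prop :=
  ∀ f : Lp ℝ 2 m, Tendsto
    (fun β : ℝ => NormedSpace.exp (-(t * β) • (1 - β • E.resolvent β)) f) atTop (𝓝 (S f))

open Classical in
/-- The semigroup `T_t`, `t > 0`, of a closed form (the strong limit above exists by the
Hille–Yosida theorem and is unique). -/
def FormOn.semigroup {m : Measure X} (E : FormOn m) (t : ℝ) : Lp ℝ 2 m →L[ℝ] Lp ℝ 2 m :=
  if h : ∃ S, E.IsSemigroupOperator t S then h.choose else 0

/-- The bounded form `(A u, v)`, with domain all of `L²`. -/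
def FormOn.ofOperator {m : Measure X} (A : Lp ℝ 2 m →L[ℝ] Lp ℝ 2 m) : FormOn m where
  dom := ⊤
  form := LinearMap.BilinForm.restrict
    ((innerₗ (Lp ℝ 2 m)).comp (A : Lp ℝ 2 m →ₗ[ℝ] Lp ℝ 2 m)) ⊤

theorem FormOn.ofOperator_form {m : Measure X} (A : Lp ℝ 2 m →L[ℝ] Lp ℝ 2 m)
    (u v : (FormOn.ofOperator A).dom) :
    (FormOn.ofOperator A).form u v = inner ℝ (A (u : Lp ℝ 2 m)) (v : Lp ℝ 2 m) := rfl

/-- The time-dependent approximation `E^{(t)}[u] = t⁻¹ (u - T_t u, u)`. -/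
def FormOn.timeApprox {m : Measure X} (E : FormOn m) (t : ℝ) : FormOn m :=
  FormOn.ofOperator (t⁻¹ • (1 - E.semigroup t))

/-- The Deny–Yosida approximation `E^{(β)}[u] = β (u - β K_β u, u)`. -/
def FormOn.denyYosida {m : Measure X} (E : FormOn m) (β : ℝ) : FormOn m :=
  FormOn.ofOperator (β • (1 - β • E.resolvent β))

/-- An increasing sequence of integrable functions `0 < φ_k ≤ 1` (hence in `L²`) with
`φ_k ↑ 1` almost everywhere. -/
structure IsExhaustion {m : Measure X} (φ : ℕ → Lp ℝ 2 m) : Prop where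
  integrable : ∀ k, Integrable (φ k) m
  pos : ∀ k, ∀ᵐ x ∂m, 0 < φ k x
  le_one : ∀ k, ∀ᵐ x ∂m, φ k x ≤ 1
  mono : Monotone φ
  tendsto : ∀ᵐ x ∂m, Tendsto (fun k => φ k x) atTop (𝓝 1)

theorem exists_isExhaustion (m : Measure X) [SigmaFinite m] :
    ∃ φ : ℕ → Lp ℝ 2 m, IsExhaustion φ := by
  obtain ⟨w, wpos, wmeas, wint⟩ :=
    exists_pos_lintegral_lt_of_sigmaFinite m (ε := 1) one_ne_zero
  have hwi : Integrable (fun x => (w x : ℝ)) m := by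
    refine ⟨wmeas.coe_nnreal_real.aestronglyMeasurable, ?_⟩
    rw [hasFiniteIntegral_iff_enorm]
    refine lt_of_le_of_lt (le_of_eq ?_) (wint.trans ENNReal.one_lt_top)
    refine lintegral_congr fun x => ?_
    simp
  let g : ℕ → X → ℝ := fun k x => min 1 ((k + 1 : ℝ) * w x)
  have hgm : ∀ k, Measurable (g k) := fun k =>
    measurable_const.min (wmeas.coe_nnreal_real.const_mul _)
  have hgpos : ∀ k x, 0 < g k x := fun k x =>
    lt_min one_pos (mul_pos (by positivity) (by exact_mod_cast wpos x))
  have hgi : ∀ k, Integrable (g k) m := fun k => by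
    refine (hwi.const_mul (k + 1 : ℝ)).mono' (hgm k).aestronglyMeasurable (ae_of_all _ fun x => ?_)
    rw [Real.norm_of_nonneg (hgpos k x).le]
    exact min_le_right _ _
  have hg2 : ∀ k, MemLp (g k) 2 m := fun k => by
    rw [memLp_two_iff_integrable_sq (hgm k).aestronglyMeasurable]
    refine (hgi k).mono' ((hgm k).pow_const 2).aestronglyMeasurable (ae_of_all _ fun x => ?_)
    rw [Real.norm_of_nonneg (sq_nonneg _)]
    have h1 : g k x ≤ 1 := min_le_left _ _
    nlinarith [hgpos k x]
  refine ⟨fun k => (hg2 k).toLp (g k), ?_, ?_, ?_, ?_, ?_⟩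
  · exact fun k => (hgi k).congr (hg2 k).coeFn_toLp.symm
  · intro k
    filter_upwards [(hg2 k).coeFn_toLp] with x hx
    rw [hx]
    exact hgpos k x
  · intro k
    filter_upwards [(hg2 k).coeFn_toLp] with x hx
    rw [hx]
    exact min_le_left _ _
  · intro j k hjk
    rw [← Lp.coeFn_le]
    filter_upwards [(hg2 j).coeFn_toLp, (hg2 k).coeFn_toLp] with x hx hy
    rw [hx, hy]
    have : (j : ℝ) ≤ k := by exact_mod_cast hjk
    exact min_le_min_left _ (mul_le_mul_of_nonneg_right (by linarith) (w x).2)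
  · have hall : ∀ᵐ x ∂m, ∀ k, (hg2 k).toLp (g k) x = g k x :=
      ae_all_iff.2 fun k => (hg2 k).coeFn_toLp
    filter_upwards [hall] with x hx
    simp only [hx]
    have hw : (0 : ℝ) < w x := by exact_mod_cast wpos x
    have htop : Tendsto (fun k : ℕ => (k + 1 : ℝ) * w x) atTop atTop :=
      (tendsto_atTop_add_const_right _ _ tendsto_natCast_atTop_atTop).atTop_mul_const hw
    refine tendsto_const_nhds.congr' ?_
    filter_upwards [htop.eventually_ge_atTop 1] with k hk
    exact (min_eq_left hk).symm

/-- A fixed exhausting sequence `φ_k ↑ 1`. -/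
def exhaustion (m : Measure X) [SigmaFinite m] : ℕ → Lp ℝ 2 m :=
  (exists_isExhaustion m).choose

theorem isExhaustion_exhaustion (m : Measure X) [SigmaFinite m] :
    IsExhaustion (exhaustion m) :=
  (exists_isExhaustion m).choose_spec

/-- The value `T_t 1` of the extension of `T_t` to `L^∞` at the constant function `1`, i.e. the
almost everywhere limit of `T_t φ_k` for `φ_k ↑ 1`. -/
def FormOn.semigroupOne {m : Measure X} [SigmaFinite m] (E : FormOn m) (t : ℝ) : X → ℝ :=
  fun x => limUnder atTop (fun k : ℕ => E.semigroup t (exhaustion m k) x)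

/-- `E` is conservative: `T_t 1 = 1` a.e. for every `t > 0`. -/
def FormOn.IsConservative {m : Measure X} [SigmaFinite m] (E : FormOn m) : Prop :=
  ∀ t : ℝ, 0 < t → ∀ᵐ x ∂m, E.semigroupOne t x = 1

/-- `E` is dissipative: `m {T_t 1 < 1} > 0` for some `t > 0`. -/
def FormOn.IsDissipative {m : Measure X} [SigmaFinite m] (E : FormOn m) : Prop :=
  ∃ t : ℝ, 0 < t ∧ 0 < m {x | E.semigroupOne t x < 1}

/-- `Y` is (a version of) the conservative space `⋂_{t>0} {T_t 1 = 1}` of `E`. Since `T_t 1` is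
defined up to null sets and the intersection is uncountable, it is the intersection in the measure
algebra: the largest measurable set, up to null sets, on which `T_t 1 = 1` a.e. for every `t`. -/
structure FormOn.IsConservativeSpace {m : Measure X} [SigmaFinite m] (E : FormOn m)
    (Y : Set X) : Prop where
  measurableSet : MeasurableSet Y
  eq_one : ∀ t : ℝ, 0 < t → ∀ᵐ x ∂m, x ∈ Y → E.semigroupOne t x = 1
  greatest : ∀ Z : Set X, MeasurableSet Z →
    (∀ t : ℝ, 0 < t → ∀ᵐ x ∂m, x ∈ Z → E.semigroupOne t x = 1) → ∀ᵐ x ∂m, x ∈ Z → x ∈ Y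

/-- `Y` is (a version of) the dissipative space of `E`, the complement of the conservative
space. -/
def FormOn.IsDissipativeSpace {m : Measure X} [SigmaFinite m] (E : FormOn m)
    (Y : Set X) : Prop :=
  E.IsConservativeSpace Yᶜ

end DirichletForms

end

/-! Conservativeness on a set is a statement about mass. If `S` is symmetric and sub-Markovian and
`0 ≤ f ≤ 1` is integrable, then `∫ S1 · f = ∫ S f ≤ ∫ f`. Taking `f = 1_Z φ₀`, positive exactly on
`Z`, shows that `S1 = 1` a.e. on `Z` iff `S` preserves the mass of `f`
(`IsSubMarkovian.applyOne_eq_one_iff`).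

Both approximating forms are `c (1 - P)` with `P` sub-Markovian, `P = T_t` or `P = β K_β`, so their
semigroup is the Poisson mixture of the powers `P ^ n`. No power increases mass and all weights are
positive, so the mixture preserves mass iff every `P ^ n` does (`integral_exp_eq_iff`).

It remains to compare the powers of `P` with the semigroup of `E`. For `P = T_t` the powers are
`T_{nt}`, and mass decreases in time (`semigroup_pow_conserves_iff`). For `P = β K_β` one uses that
`β K_β` is the average of `T_s` with weight `β e^{-βs}` (`resolvent_pow_conserves_iff`). Thus each
form satisfies `T1 = 1` on the same measurable sets, and all the claims follow.

Resolvent and semigroup are defined by choice with default `0`, so their existence and basic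
properties have to be established beforehand. -/

namespace DirichletForms

/-! ### Exponentials of bounded operators. -/

section Exponential

variable {H : Type*} [NormedAddCommGroup H] [NormedSpace ℝ H] [CompleteSpace H]

theorem exp_add_of_commute_clm {A B : H →L[ℝ] H} (h : Commute A B) :
    NormedSpace.exp (A + B) = NormedSpace.exp A * NormedSpace.exp B :=
  letI : NormedAlgebra ℚ (H →L[ℝ] H) := NormedAlgebra.restrictScalars ℚ ℝ _
  NormedSpace.exp_add_of_commute h

theorem exp_continuous_clm : Continuous (NormedSpace.exp : (H →L[ℝ] H) → H →L[ℝ] H) :=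
  letI : NormedAlgebra ℚ (H →L[ℝ] H) := NormedAlgebra.restrictScalars ℚ ℝ _
  NormedSpace.exp_continuous

theorem exp_neg_smul_one_sub (c : ℝ) (P : H →L[ℝ] H) :
    NormedSpace.exp (-c • (1 - P)) = Real.exp (-c) • NormedSpace.exp (c • P) := by
  have h : -c • (1 - P) = algebraMap ℝ (H →L[ℝ] H) (-c) + c • P := by
    rw [Algebra.algebraMap_eq_smul_one, smul_sub, neg_smul, neg_smul, sub_neg_eq_add]
  rw [h, exp_add_of_commute_clm (Algebra.commute_algebraMap_left _ _), ← NormedSpace.algebraMap_exp_comm,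
    ← Real.exp_eq_exp_ℝ, Algebra.algebraMap_eq_smul_one, smul_mul_assoc, one_mul]

/-- The Poisson mixture of the powers of `P`: contractivity, the sub-Markov property and the mass
formula are all read off from it. -/
theorem hasSum_exp_neg_smul_one_sub_apply (c : ℝ) (P : H →L[ℝ] H) (f : H) :
    HasSum (fun n : ℕ => (Real.exp (-c) * (c ^ n / n.factorial)) • (P ^ n) f)
      (NormedSpace.exp (-c • (1 - P)) f) := by
  rw [exp_neg_smul_one_sub]
  have h := ((NormedSpace.exp_series_hasSum_exp' (𝕂 := ℝ) (c • P)).mapL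
    (ContinuousLinearMap.apply ℝ H f)).const_smul (Real.exp (-c))
  convert h using 1
  · ext1 n
    simp only [ContinuousLinearMap.apply_apply, smul_pow, smul_smul, smul_apply]
    congr 1
    ring
  · rfl

theorem hasSum_poisson (c : ℝ) :
    HasSum (fun n : ℕ => Real.exp (-c) * (c ^ n / n.factorial)) 1 := by
  have h := (NormedSpace.expSeries_div_hasSum_exp c).mul_left (Real.exp (-c))
  rwa [← Real.exp_eq_exp_ℝ, ← Real.exp_add, neg_add_cancel, Real.exp_zero] at h

theorem poisson_pos {c : ℝ} (hc : 0 < c) (n : ℕ) :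
    0 < Real.exp (-c) * (c ^ n / n.factorial) := by
  positivity

theorem poisson_nonneg {c : ℝ} (hc : 0 ≤ c) (n : ℕ) :
    0 ≤ Real.exp (-c) * (c ^ n / n.factorial) := by
  positivity

theorem norm_exp_neg_smul_one_sub_le {c : ℝ} (hc : 0 ≤ c) {P : H →L[ℝ] H} (hP : ‖P‖ ≤ 1) :
    ‖NormedSpace.exp (-c • (1 - P))‖ ≤ 1 := by
  refine ContinuousLinearMap.opNorm_le_bound _ zero_le_one fun f => ?_
  have hs := hasSum_exp_neg_smul_one_sub_apply c P f
  rw [← hs.tsum_eq]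
  refine tsum_of_norm_bounded ((hasSum_poisson c).mul_right ‖f‖) fun n => ?_
  rw [norm_smul, Real.norm_of_nonneg (poisson_nonneg hc n)]
  refine mul_le_mul_of_nonneg_left ?_ (poisson_nonneg hc n)
  induction n with
  | zero => simp
  | succ n ih =>
    rw [pow_succ', mul_apply_eq_comp]
    exact (P.le_of_opNorm_le hP _).trans (by simpa using ih)

/-- Duhamel's argument: `exp(-tB) exp(s(B - A)) f` interpolates between the two vectors for `0 ≤ s ≤
t`. By commutation its derivative is `exp(-sA) exp(-(t-s)B) (B - A) f`, where both exponentials are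
contractions. -/
theorem norm_exp_sub_exp_apply_le {A B : H →L[ℝ] H} (hAB : Commute A B)
    (hA : ∀ s : ℝ, 0 ≤ s → ‖NormedSpace.exp (-s • A)‖ ≤ 1)
    (hB : ∀ s : ℝ, 0 ≤ s → ‖NormedSpace.exp (-s • B)‖ ≤ 1) {t : ℝ} (ht : 0 ≤ t) (f : H) :
    ‖NormedSpace.exp (-t • A) f - NormedSpace.exp (-t • B) f‖ ≤ ‖A f - B f‖ * t := by
  set g : ℝ → H := fun s => NormedSpace.exp (-t • B) (NormedSpace.exp (s • (B - A)) f) with hg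
  have hd : ∀ s : ℝ, HasDerivAt g
      (NormedSpace.exp (-t • B) ((NormedSpace.exp (s • (B - A)) * (B - A)) f)) s := fun s =>
    (NormedSpace.exp (-t • B)).hasFDerivAt.comp_hasDerivAt s
      (((ContinuousLinearMap.apply ℝ H f).hasFDerivAt.comp_hasDerivAt s
        (hasDerivAt_exp_smul_const (B - A) s)))
  have hb : ∀ s ∈ Set.Ico 0 t,
      ‖NormedSpace.exp (-t • B) ((NormedSpace.exp (s • (B - A)) * (B - A)) f)‖ ≤ ‖A f - B f‖ := by
    intro s hs
    have e : NormedSpace.exp (-t • B) * NormedSpace.exp (s • (B - A))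
        = NormedSpace.exp (-s • A) * NormedSpace.exp (-(t - s) • B) := by
      rw [← exp_add_of_commute_clm, ← exp_add_of_commute_clm]
      · congr 1; module
      · exact (hAB.smul_left _).smul_right _
      · exact ((Commute.refl B).sub_right hAB.symm |>.smul_right _).smul_left _
    have : NormedSpace.exp (-t • B) ((NormedSpace.exp (s • (B - A)) * (B - A)) f)
        = NormedSpace.exp (-s • A) (NormedSpace.exp (-(t - s) • B) (B f - A f)) := by
      have := congrArg (fun T : H →L[ℝ] H => T (B f - A f)) e
      simpa using this
    rw [this, norm_sub_rev]
    refine (ContinuousLinearMap.le_of_opNorm_le _ (hA s hs.1) _).trans ?_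
    rw [one_mul]
    refine (ContinuousLinearMap.le_of_opNorm_le _ (hB _ (sub_nonneg.2 hs.2.le)) _).trans ?_
    rw [one_mul]
  have := norm_image_sub_le_of_norm_deriv_le_segment' (fun s _ => (hd s).hasDerivWithinAt) hb t
    (Set.right_mem_Icc.2 ht)
  have e1 : g t = NormedSpace.exp (-t • A) f := by
    simp only [hg]
    rw [← mul_apply_eq_comp, ← exp_add_of_commute_clm]
    · congr 2; module
    · exact ((Commute.refl B).sub_right hAB.symm |>.smul_right _).smul_left _
  have e0 : g 0 = NormedSpace.exp (-t • B) f := by simp [hg, NormedSpace.exp_zero]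
  rwa [e1, e0, sub_zero] at this

end Exponential

/-! ### The resolvent of a closed form. -/

variable {X : Type*} [MeasurableSpace X] {m : Measure X} {E : FormOn m}

/-- Densely defined closed nonnegative symmetric forms, without the Markov property. -/
structure FormOn.IsClosedForm (E : FormOn m) : Prop where
  symm : ∀ u v : E.dom, E.form u v = E.form v u
  nonneg : ∀ u : E.dom, 0 ≤ E.form u u
  dense : Dense (E.dom : Set (Lp ℝ 2 m))
  closed : ∀ u : ℕ → E.dom,
    (∀ ε > 0, ∃ N, ∀ j ≥ N, ∀ k ≥ N,
      E.form (u j - u k) (u j - u k) + ‖(u j : Lp ℝ 2 m) - (u k : Lp ℝ 2 m)‖ ^ 2 < ε) →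
    ∃ w : E.dom, Tendsto
      (fun j => E.form (u j - w) (u j - w) + ‖(u j : Lp ℝ 2 m) - (w : Lp ℝ 2 m)‖ ^ 2)
      atTop (𝓝 0)

theorem FormOn.IsDirichletForm.isClosedForm (hE : E.IsDirichletForm) : E.IsClosedForm :=
  ⟨hE.symm, hE.nonneg, hE.dense, hE.closed⟩

/-- A copy of the domain of a form, to be normed by the form. -/
def FormOn.Domain (E : FormOn m) : Type _ := E.dom

noncomputable instance : AddCommGroup E.Domain := inferInstanceAs (AddCommGroup E.dom)

noncomputable instance : Module ℝ E.Domain := inferInstanceAs (Module ℝ E.dom)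

/-- The inclusion of the domain of a form in `L²`. -/
noncomputable def FormOn.Domain.incl (E : FormOn m) : E.Domain →ₗ[ℝ] Lp ℝ 2 m := E.dom.subtype

/-- The form, as a bilinear form on the copy of its domain. -/
noncomputable def FormOn.Domain.form (E : FormOn m) : LinearMap.BilinForm ℝ E.Domain := E.form

/-- The inner product `E(u,v) + β (u,v)` on the domain of `E`. -/
@[reducible]
noncomputable def FormOn.IsClosedForm.core (hE : E.IsClosedForm) {β : ℝ} (hβ : 0 < β) :
    InnerProductSpace.Core ℝ E.Domain where
  inner u v := Domain.form E u v + β * inner ℝ (Domain.incl E u) (Domain.incl E v)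
  conj_inner_symm u v := by
    have := hE.symm u v
    change E.form v u + β * _ = E.form u v + β * _
    rw [this, real_inner_comm]
  re_inner_nonneg u := add_nonneg (hE.nonneg u) (mul_nonneg hβ.le real_inner_self_nonneg)
  add_left u v w := by
    simp only [map_add, LinearMap.add_apply, inner_add_left]
    ring
  smul_left u v r := by
    simp only [map_smul, LinearMap.smul_apply, real_inner_smul_left, smul_eq_mul, conj_trivial]
    ring
  definite u h := by
    have h1 : 0 ≤ Domain.form E u u := hE.nonneg u
    have h2 : 0 ≤ inner ℝ (Domain.incl E u) (Domain.incl E u) := real_inner_self_nonneg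
    have h3 : inner ℝ (Domain.incl E u) (Domain.incl E u) = 0 := by
      have : β * inner ℝ (Domain.incl E u) (Domain.incl E u) = 0 := by
        have := mul_nonneg hβ.le h2
        linarith
      exact (mul_eq_zero.1 this).resolve_left hβ.ne'
    exact Subtype.ext (inner_self_eq_zero.1 h3)

/-- Closedness makes the domain a Hilbert space for `E(u,v) + β (u,v)`. If `J` is its embedding in
`L²`, then `K = J J*`, because `⟨J* f, v⟩ = (f, J v)` is the equation defining the resolvent. -/
theorem FormOn.IsClosedForm.exists_isResolvent (hE : E.IsClosedForm) {β : ℝ} (hβ : 0 < β) :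
    ∃ K, E.IsResolvent β K := by
  let core := hE.core hβ
  let : NormedAddCommGroup E.Domain := core.toNormedAddCommGroup
  let : InnerProductSpace ℝ E.Domain := InnerProductSpace.ofCore core.toCore
  have hinner : ∀ u v : E.Domain, inner ℝ u v
      = Domain.form E u v + β * inner ℝ (Domain.incl E u) (Domain.incl E v) := fun _ _ => rfl
  have hnorm : ∀ u : E.Domain, ‖u‖ ^ 2 = Domain.form E u u + β * ‖Domain.incl E u‖ ^ 2 := by
    intro u
    rw [← real_inner_self_eq_norm_sq, hinner, real_inner_self_eq_norm_sq]
  have hnn : ∀ u : E.Domain, 0 ≤ Domain.form E u u := hE.nonneg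
  have hcomplete : CompleteSpace E.Domain := by
    refine Metric.complete_of_cauchySeq_tendsto fun u hu => ?_
    obtain ⟨(w : E.Domain), hw⟩ := hE.closed u (by
      intro ε hε
      -- Closedness is stated for the weight `1` instead of `β`; the factors `min 1 β` and, below,
      -- `max 1 β` express the equivalence of the two norms.
      have hc : 0 < min 1 β := lt_min one_pos hβ
      obtain ⟨N, hN⟩ := Metric.cauchySeq_iff.1 hu (√(min 1 β * ε)) (by positivity)
      refine ⟨N, fun j hj k hk => ?_⟩
      have h1 := hN j hj k hk
      rw [dist_eq_norm, Real.lt_sqrt (norm_nonneg _), hnorm, map_sub (Domain.incl E)] at h1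
      have h2 := hnn (u j - u k)
      have h3 := sq_nonneg ‖Domain.incl E (u j) - Domain.incl E (u k)‖
      change Domain.form E (u j - u k) (u j - u k)
        + ‖Domain.incl E (u j) - Domain.incl E (u k)‖ ^ 2 < ε
      refine lt_of_mul_lt_mul_left (lt_of_le_of_lt ?_ h1) hc.le
      rw [mul_add]
      exact add_le_add (mul_le_of_le_one_left h2 (min_le_left _ _))
        (mul_le_mul_of_nonneg_right (min_le_right _ _) h3))
    refine ⟨w, tendsto_iff_norm_sub_tendsto_zero.2 ?_⟩
    have h0 : Tendsto (fun j => ‖u j - w‖ ^ 2) atTop (𝓝 0) := by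
      have hw' := hw.const_mul (max 1 β)
      rw [mul_zero] at hw'
      refine squeeze_zero (fun _ => sq_nonneg _) (fun j => ?_) hw'
      rw [hnorm, map_sub (Domain.incl E)]
      have h2 := hnn (u j - w)
      have h3 := sq_nonneg ‖Domain.incl E (u j) - Domain.incl E w‖
      change _ ≤ max 1 β * (Domain.form E (u j - w) (u j - w)
        + ‖Domain.incl E (u j) - Domain.incl E w‖ ^ 2)
      rw [mul_add]
      exact add_le_add (le_mul_of_one_le_left h2 (le_max_left _ _))
        (mul_le_mul_of_nonneg_right (le_max_right _ _) h3)
    simpa [Real.sqrt_sq_eq_abs] using h0.sqrt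
  let J : E.Domain →L[ℝ] Lp ℝ 2 m := (Domain.incl E).mkContinuous (√β)⁻¹ (by
    intro u
    rw [inv_mul_eq_div, le_div_iff₀ (Real.sqrt_pos.2 hβ)]
    refine le_of_sq_le_sq ?_ (norm_nonneg _)
    rw [mul_pow, Real.sq_sqrt hβ.le, hnorm]
    linarith [hnn u])
  refine ⟨J.comp (ContinuousLinearMap.adjoint J), fun f => ⟨?_, fun v => ?_⟩⟩
  · exact (show E.dom from ContinuousLinearMap.adjoint J f).2
  · have := ContinuousLinearMap.adjoint_inner_left J (show E.Domain from v) f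
    rw [hinner] at this
    exact this

theorem FormOn.IsClosedForm.isResolvent (hE : E.IsClosedForm) {β : ℝ} (hβ : 0 < β) :
    E.IsResolvent β (E.resolvent β) := by
  have h := hE.exists_isResolvent hβ
  rw [FormOn.resolvent, dif_pos h]
  exact h.choose_spec

namespace FormOn.IsClosedForm

variable (hE : E.IsClosedForm) {β γ : ℝ} (hβ : 0 < β) (hγ : 0 < γ)
include hE hβ

theorem resolvent_mem (f : Lp ℝ 2 m) : E.resolvent β f ∈ E.dom :=
  (hE.isResolvent hβ f).choose

theorem form_resolvent (f : Lp ℝ 2 m) (v : E.dom) :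
    E.form ⟨E.resolvent β f, hE.resolvent_mem hβ f⟩ v
      + β * inner ℝ (E.resolvent β f) (v : Lp ℝ 2 m) = inner ℝ f (v : Lp ℝ 2 m) :=
  (hE.isResolvent hβ f).choose_spec v

theorem resolvent_eq_of_forall (f : Lp ℝ 2 m) (u : E.dom)
    (hu : ∀ v : E.dom, E.form u v + β * inner ℝ (u : Lp ℝ 2 m) (v : Lp ℝ 2 m)
      = inner ℝ f (v : Lp ℝ 2 m)) : E.resolvent β f = u := by
  set w : E.dom := ⟨E.resolvent β f, hE.resolvent_mem hβ f⟩ - u with hw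
  have h1 := hu w
  have h2 := hE.form_resolvent hβ f w
  have h3 : E.form w w + β * inner ℝ (w : Lp ℝ 2 m) (w : Lp ℝ 2 m) = 0 := by
    have e1 : E.form w w = E.form ⟨E.resolvent β f, hE.resolvent_mem hβ f⟩ w - E.form u w := by
      rw [← LinearMap.sub_apply, ← map_sub]
    have e2 : inner ℝ (w : Lp ℝ 2 m) (w : Lp ℝ 2 m)
        = inner ℝ (E.resolvent β f) (w : Lp ℝ 2 m) - inner ℝ (u : Lp ℝ 2 m) (w : Lp ℝ 2 m) := by
      rw [← inner_sub_left]; rfl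
    rw [e1, e2]
    linarith
  have h4 := hE.nonneg w
  have h5 : inner ℝ (w : Lp ℝ 2 m) (w : Lp ℝ 2 m) = 0 := by
    have h6 : 0 ≤ inner ℝ (w : Lp ℝ 2 m) (w : Lp ℝ 2 m) := real_inner_self_nonneg
    nlinarith
  exact sub_eq_zero.1 (inner_self_eq_zero.1 h5)

theorem norm_resolvent_apply_le (f : Lp ℝ 2 m) : β * ‖E.resolvent β f‖ ≤ ‖f‖ := by
  have h1 := hE.form_resolvent hβ f ⟨E.resolvent β f, hE.resolvent_mem hβ f⟩
  have h2 := hE.nonneg ⟨E.resolvent β f, hE.resolvent_mem hβ f⟩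
  simp only [real_inner_self_eq_norm_sq] at h1
  have h3 := real_inner_le_norm f (E.resolvent β f)
  rcases (norm_nonneg (E.resolvent β f)).eq_or_lt with h0 | h0
  · rw [← h0, mul_zero]; exact norm_nonneg f
  · refine le_of_mul_le_mul_right ?_ h0
    nlinarith

theorem norm_smul_resolvent_le : ‖β • E.resolvent β‖ ≤ 1 := by
  refine ContinuousLinearMap.opNorm_le_bound _ zero_le_one fun f => ?_
  rw [one_mul, smul_apply, norm_smul, Real.norm_of_nonneg hβ.le]
  exact hE.norm_resolvent_apply_le hβ f

theorem resolvent_symm (f g : Lp ℝ 2 m) :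
    inner ℝ (E.resolvent β f) g = inner ℝ f (E.resolvent β g) := by
  have h1 := hE.form_resolvent hβ f ⟨E.resolvent β g, hE.resolvent_mem hβ g⟩
  have h2 := hE.form_resolvent hβ g ⟨E.resolvent β f, hE.resolvent_mem hβ f⟩
  rw [hE.symm] at h2
  simp only at h1 h2
  rw [real_inner_comm, ← h2, ← h1, real_inner_comm]

include hγ in
theorem resolvent_equation (f : Lp ℝ 2 m) :
    E.resolvent γ (f + (γ - β) • E.resolvent β f) = E.resolvent β f := by
  refine hE.resolvent_eq_of_forall hγ _ ⟨E.resolvent β f, hE.resolvent_mem hβ f⟩ fun v => ?_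
  rw [inner_add_left, real_inner_smul_left, ← hE.form_resolvent hβ f v]
  ring

include hγ in
-- The resolvent equation with the parameters in both orders writes `K_β - K_γ` as `(γ - β) K_γ K_β`
-- and as `(γ - β) K_β K_γ`.
theorem commute_resolvent : Commute (E.resolvent β) (E.resolvent γ) := by
  rcases eq_or_ne γ β with rfl | hne
  · exact Commute.refl _
  have h1 : E.resolvent β - E.resolvent γ = (γ - β) • (E.resolvent γ * E.resolvent β) := by
    ext1 f
    have := hE.resolvent_equation hβ hγ f
    rw [map_add, map_smul] at this
    rw [sub_apply, sub_eq_iff_eq_add, ← this, add_comm]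
    simp
  have h2 : E.resolvent γ - E.resolvent β = (β - γ) • (E.resolvent β * E.resolvent γ) := by
    ext1 f
    have := hE.resolvent_equation hγ hβ f
    rw [map_add, map_smul] at this
    rw [sub_apply, sub_eq_iff_eq_add, ← this, add_comm]
    simp
  refine smul_right_injective _ (sub_ne_zero.2 hne) (?_ : (γ - β) • _ = (γ - β) • _)
  rw [← h1, ← neg_sub β γ, neg_smul, ← h2, neg_sub]

/-- By symmetry a vector `h` orthogonal to the range satisfies `K_β h = 0`; the weak equation then
makes `h` orthogonal to the dense domain. -/
theorem denseRange_resolvent : DenseRange (E.resolvent β) := by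
  have h : (LinearMap.range (E.resolvent β : Lp ℝ 2 m →ₗ[ℝ] Lp ℝ 2 m)).topologicalClosure = ⊤ := by
    rw [Submodule.topologicalClosure_eq_top_iff, Submodule.eq_bot_iff]
    intro h hh
    have h0 : E.resolvent β h = 0 := by
      refine ext_inner_left ℝ fun f => ?_
      rw [← hE.resolvent_symm hβ, inner_zero_right]
      exact hh _ ⟨f, rfl⟩
    refine hE.dense.eq_zero_of_inner_left ℝ fun v hv => ?_
    lift v to E.dom using hv
    rw [← hE.form_resolvent hβ h v]
    have : (⟨E.resolvent β h, hE.resolvent_mem hβ h⟩ : E.dom) = 0 := Subtype.ext h0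
    rw [this, h0]
    simp
  rw [← Submodule.dense_iff_topologicalClosure_eq_top] at h
  exact h

end FormOn.IsClosedForm

/-! ### Yosida approximation and the construction of the semigroup. -/

theorem tendsto_zero_of_dense {ι H : Type*} [NormedAddCommGroup H] [NormedSpace ℝ H]
    {l : Filter ι} {L : ι → H →L[ℝ] H} {C : ℝ} (hC : ∀ᶠ i in l, ‖L i‖ ≤ C) {D : Set H}
    (hD : Dense D) (h : ∀ f ∈ D, Tendsto (fun i => L i f) l (𝓝 0)) (f : H) :
    Tendsto (fun i => L i f) l (𝓝 0) := by
  rw [Metric.tendsto_nhds]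
  intro ε hε
  have hc : 0 < |C| + 1 := by positivity
  obtain ⟨g, hg, hfg⟩ := Metric.dense_iff.1 hD f (ε / 2 / (|C| + 1)) (by positivity)
  rw [Metric.mem_ball, dist_eq_norm, norm_sub_rev] at hg
  filter_upwards [hC, Metric.tendsto_nhds.1 (h g hfg) (ε / 2) (half_pos hε)] with i h1 h2
  rw [dist_zero_right] at h2 ⊢
  have h3 : ‖L i (f - g)‖ < ε / 2 := by
    refine lt_of_le_of_lt ((L i).le_of_opNorm_le (h1.trans (le_abs_self C)) _) ?_
    calc |C| * ‖f - g‖ ≤ (|C| + 1) * ‖f - g‖ := by gcongr; linarith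
      _ < (|C| + 1) * (ε / 2 / (|C| + 1)) := by gcongr
      _ = ε / 2 := by field_simp
  calc ‖L i f‖ = ‖L i (f - g) + L i g‖ := by rw [map_sub, sub_add_cancel]
    _ ≤ ‖L i (f - g)‖ + ‖L i g‖ := norm_add_le _ _
    _ < ε := by linarith

theorem inner_exp_neg_smul_one_sub {H : Type*} [NormedAddCommGroup H] [InnerProductSpace ℝ H]
    [CompleteSpace H] {P : H →L[ℝ] H} (hP : ∀ f g, inner ℝ (P f) g = inner ℝ f (P g))
    (c : ℝ) (f g : H) :
    inner ℝ (NormedSpace.exp (-c • (1 - P)) f) g = inner ℝ f (NormedSpace.exp (-c • (1 - P)) g) := by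
  have hpow : ∀ n : ℕ, ∀ f g, inner ℝ ((P ^ n) f) g = inner ℝ f ((P ^ n) g) := by
    intro n
    induction n with
    | zero => simp
    | succ n ih =>
      intro f g
      rw [pow_succ', mul_apply_eq_comp, hP, ih, ← mul_apply_eq_comp, ← pow_succ, ← pow_succ']
  have h1 := (hasSum_exp_neg_smul_one_sub_apply c P f).mapL (innerSL ℝ g)
  have h2 := (hasSum_exp_neg_smul_one_sub_apply c P g).mapL (innerSL ℝ f)
  simp only [innerSL_apply_apply, inner_smul_right] at h1 h2
  rw [real_inner_comm]
  refine h1.unique ?_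
  convert h2 using 3 with n
  rw [real_inner_comm, hpow]

/-- The semigroup `exp (-t β (1 - β K_β))` of the Deny–Yosida approximation. -/
noncomputable def FormOn.yosidaSemigroup (E : FormOn m) (β t : ℝ) : Lp ℝ 2 m →L[ℝ] Lp ℝ 2 m :=
  NormedSpace.exp (-(t * β) • (1 - β • E.resolvent β))

theorem FormOn.yosidaSemigroup_eq (E : FormOn m) (β t : ℝ) :
    E.yosidaSemigroup β t = NormedSpace.exp (-t • (β • (1 - β • E.resolvent β))) := by
  rw [FormOn.yosidaSemigroup, smul_smul, neg_mul]

theorem FormOn.yosidaSemigroup_add (E : FormOn m) (β s t : ℝ) :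
    E.yosidaSemigroup β (s + t) = E.yosidaSemigroup β s * E.yosidaSemigroup β t := by
  rw [yosidaSemigroup, yosidaSemigroup, yosidaSemigroup, ← exp_add_of_commute_clm]
  · congr 1; module
  · exact ((Commute.refl _).smul_left _).smul_right _

theorem FormOn.yosidaSemigroup_zero (E : FormOn m) (β : ℝ) : E.yosidaSemigroup β 0 = 1 := by
  simp [yosidaSemigroup, NormedSpace.exp_zero]

namespace FormOn.IsClosedForm

variable (hE : E.IsClosedForm) {β γ t s : ℝ}
include hE

theorem norm_yosidaSemigroup_le (hγ : 0 < γ) (ht : 0 ≤ t) : ‖E.yosidaSemigroup γ t‖ ≤ 1 :=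
  norm_exp_neg_smul_one_sub_le (by positivity) (hE.norm_smul_resolvent_le hγ)

/-- On the range of `K_β` the Yosida generators are bounded uniformly in `γ`, since `γ K_γ` is a
contraction. By density this drives every limit `γ → ∞` below. -/
theorem yosida_resolvent (hβ : 0 < β) (hγ : 0 < γ) (f : Lp ℝ 2 m) :
    (γ • (1 - γ • E.resolvent γ)) (E.resolvent β f)
      = (γ • E.resolvent γ) (f - β • E.resolvent β f) := by
  have h := hE.resolvent_equation hβ hγ f
  rw [map_add, map_smul] at h
  simp only [smul_apply, sub_apply, one_apply_eq_self, map_sub, map_smul]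
  nth_rw 1 [← h]
  module

theorem tendsto_smul_resolvent (f : Lp ℝ 2 m) :
    Tendsto (fun γ : ℝ => (γ • E.resolvent γ) f) atTop (𝓝 f) := by
  have key : Tendsto (fun γ : ℝ => (γ • E.resolvent γ - 1) f) atTop (𝓝 0) := by
    refine tendsto_zero_of_dense (C := 1 + 1) ?_ (hE.denseRange_resolvent one_pos) ?_ f
    · filter_upwards [eventually_gt_atTop 0] with γ hγ
      exact (norm_sub_le _ _).trans
        (add_le_add (hE.norm_smul_resolvent_le hγ) ContinuousLinearMap.norm_id_le)
    · rintro _ ⟨h, rfl⟩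
      have h0 : Tendsto (fun γ : ℝ => γ⁻¹ * ‖h - (1 : ℝ) • E.resolvent 1 h‖) atTop (𝓝 0) := by
        simpa using tendsto_inv_atTop_zero.mul_const ‖h - (1 : ℝ) • E.resolvent 1 h‖
      refine squeeze_zero_norm' ?_ h0
      filter_upwards [eventually_gt_atTop 0] with γ hγ
      have h1 := hE.yosida_resolvent one_pos hγ h
      rw [← neg_sub, neg_apply, norm_neg, ← div_eq_inv_mul, le_div_iff₀' hγ]
      have h2 : ‖(γ • (1 - γ • E.resolvent γ)) (E.resolvent 1 h)‖
          = γ * ‖(1 - γ • E.resolvent γ) (E.resolvent 1 h)‖ := by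
        rw [smul_apply, norm_smul, Real.norm_of_nonneg hγ.le]
      rw [← h2, h1]
      simpa using ContinuousLinearMap.le_of_opNorm_le _ (hE.norm_smul_resolvent_le hγ)
        (h - (1 : ℝ) • E.resolvent 1 h)
  simpa using key.add_const f

theorem tendsto_yosida_resolvent (hβ : 0 < β) (f : Lp ℝ 2 m) :
    Tendsto (fun γ : ℝ => (γ • (1 - γ • E.resolvent γ)) (E.resolvent β f)) atTop
      (𝓝 (f - β • E.resolvent β f)) := by
  refine (hE.tendsto_smul_resolvent _).congr' ?_
  filter_upwards [eventually_gt_atTop 0] with γ hγ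
  exact (hE.yosida_resolvent hβ hγ f).symm

theorem commute_yosida (hβ : 0 < β) (hγ : 0 < γ) :
    Commute (β • (1 - β • E.resolvent β)) (γ • (1 - γ • E.resolvent γ)) := by
  have h := ((hE.commute_resolvent hβ hγ).smul_left β).smul_right γ
  exact ((((Commute.one_left _).sub_left (((Commute.one_right _).sub_right h))).smul_left
    β).smul_right γ)

/-- By contractivity it suffices to treat `f` in the range of `K_1`. There the Yosida generators
converge, and the Duhamel estimate transfers this to the exponentials. -/
theorem cauchy_yosidaSemigroup (ht : 0 ≤ t) (f : Lp ℝ 2 m) :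
    Cauchy (map (fun γ => E.yosidaSemigroup γ t f) atTop) := by
  rw [cauchy_map_iff]
  refine ⟨inferInstance, ?_⟩
  simp only [tendsto_uniformity_iff_dist_tendsto_zero, dist_eq_norm]
  have hpos : ∀ᶠ p : ℝ × ℝ in atTop ×ˢ atTop, 0 < p.1 ∧ 0 < p.2 :=
    (eventually_gt_atTop 0).prod_mk (eventually_gt_atTop 0)
  refine tendsto_zero_iff_norm_tendsto_zero.1 <| tendsto_zero_of_dense
    (L := fun p : ℝ × ℝ => E.yosidaSemigroup p.1 t - E.yosidaSemigroup p.2 t) (C := 1 + 1) ?_ (hE.denseRange_resolvent one_pos) ?_ f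
  · filter_upwards [hpos] with p hp
    exact (norm_sub_le _ _).trans
      (add_le_add (hE.norm_yosidaSemigroup_le hp.1 ht) (hE.norm_yosidaSemigroup_le hp.2 ht))
  · rintro _ ⟨h, rfl⟩
    have h0 := hE.tendsto_yosida_resolvent one_pos h
    have h1 : Tendsto (fun p : ℝ × ℝ =>
        ‖(p.1 • (1 - p.1 • E.resolvent p.1)) (E.resolvent 1 h)
          - (p.2 • (1 - p.2 • E.resolvent p.2)) (E.resolvent 1 h)‖ * t)
        (atTop ×ˢ atTop) (𝓝 0) := by
      simpa using (((h0.comp tendsto_fst).sub (h0.comp tendsto_snd)).norm).mul_const t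
    refine squeeze_zero_norm' ?_ h1
    filter_upwards [hpos] with p hp
    simp only [sub_apply, yosidaSemigroup_eq]
    refine norm_exp_sub_exp_apply_le (hE.commute_yosida hp.1 hp.2) ?_ ?_ ht _
    · intro s hs
      rw [← yosidaSemigroup_eq]
      exact hE.norm_yosidaSemigroup_le hp.1 hs
    · intro s hs
      rw [← yosidaSemigroup_eq]
      exact hE.norm_yosidaSemigroup_le hp.2 hs

theorem exists_isSemigroupOperator (ht : 0 ≤ t) : ∃ S, E.IsSemigroupOperator t S := by
  choose S hS using fun f => CompleteSpace.complete (hE.cauchy_yosidaSemigroup ht f)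
  exact ⟨continuousLinearMapOfTendsto (fun γ => E.yosidaSemigroup γ t) (tendsto_pi_nhds.2 hS), hS⟩

theorem tendsto_yosidaSemigroup (ht : 0 ≤ t) (f : Lp ℝ 2 m) :
    Tendsto (fun γ => E.yosidaSemigroup γ t f) atTop (𝓝 (E.semigroup t f)) := by
  have h := hE.exists_isSemigroupOperator ht
  rw [FormOn.semigroup, dif_pos h]
  exact h.choose_spec f

theorem norm_semigroup_le (ht : 0 ≤ t) : ‖E.semigroup t‖ ≤ 1 := by
  refine ContinuousLinearMap.opNorm_le_bound _ zero_le_one fun f => ?_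
  refine le_of_tendsto (hE.tendsto_yosidaSemigroup ht f).norm ?_
  filter_upwards [eventually_gt_atTop 0] with γ hγ
  exact ContinuousLinearMap.le_of_opNorm_le _ (hE.norm_yosidaSemigroup_le hγ ht) f

theorem semigroup_symm (ht : 0 ≤ t) (f g : Lp ℝ 2 m) :
    inner ℝ (E.semigroup t f) g = inner ℝ f (E.semigroup t g) := by
  refine tendsto_nhds_unique
    (((hE.tendsto_yosidaSemigroup ht f).inner tendsto_const_nhds).congr' ?_)
    (tendsto_const_nhds.inner (hE.tendsto_yosidaSemigroup ht g))
  filter_upwards [eventually_gt_atTop 0] with γ hγ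
  refine inner_exp_neg_smul_one_sub (fun f g => ?_) _ f g
  rw [smul_apply, smul_apply, real_inner_smul_left, real_inner_smul_right, hE.resolvent_symm hγ]

theorem tendsto_yosidaSemigroup_of_tendsto (ht : 0 ≤ t) {u : ℝ → Lp ℝ 2 m} {f : Lp ℝ 2 m}
    (hu : Tendsto u atTop (𝓝 f)) :
    Tendsto (fun γ => E.yosidaSemigroup γ t (u γ)) atTop (𝓝 (E.semigroup t f)) := by
  have h0 : Tendsto (fun γ => E.yosidaSemigroup γ t (u γ - f)) atTop (𝓝 0) := by
    refine squeeze_zero_norm' ?_ (tendsto_iff_norm_sub_tendsto_zero.1 hu)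
    filter_upwards [eventually_gt_atTop 0] with γ hγ
    simpa using ContinuousLinearMap.le_of_opNorm_le _ (hE.norm_yosidaSemigroup_le hγ ht) (u γ - f)
  simpa using h0.add (hE.tendsto_yosidaSemigroup ht f)

theorem semigroup_add (hs : 0 ≤ s) (ht : 0 ≤ t) :
    E.semigroup (s + t) = E.semigroup s * E.semigroup t := by
  ext1 f
  refine tendsto_nhds_unique (hE.tendsto_yosidaSemigroup (add_nonneg hs ht) f) ?_
  simp only [yosidaSemigroup_add, mul_apply_eq_comp]
  exact hE.tendsto_yosidaSemigroup_of_tendsto hs (hE.tendsto_yosidaSemigroup ht f)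

theorem semigroup_zero : E.semigroup 0 = 1 := by
  ext1 f
  refine tendsto_nhds_unique (hE.tendsto_yosidaSemigroup le_rfl f) ?_
  simp only [yosidaSemigroup_zero, one_apply_eq_self]
  exact tendsto_const_nhds

theorem semigroup_resolvent_comm (ht : 0 ≤ t) (hβ : 0 < β) (f : Lp ℝ 2 m) :
    E.semigroup t (E.resolvent β f) = E.resolvent β (E.semigroup t f) := by
  refine tendsto_nhds_unique ((hE.tendsto_yosidaSemigroup ht (E.resolvent β f)).congr' ?_)
    (((E.resolvent β).continuous.tendsto _).comp (hE.tendsto_yosidaSemigroup ht f))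
  filter_upwards [eventually_gt_atTop 0] with γ hγ
  have h : Commute (E.resolvent β) (E.yosidaSemigroup γ t) :=
    (((Commute.one_right _).sub_right
      ((hE.commute_resolvent hβ hγ).smul_right γ)).smul_right _).exp_right
  exact (congrArg (fun T : Lp ℝ 2 m →L[ℝ] Lp ℝ 2 m => T f) h.eq).symm

/-- Strong continuity is not needed: measurability in `s` is inherited from the continuous Yosida
approximations, and `‖f‖` is a bound. -/
theorem intervalIntegrable_semigroup (ht : 0 ≤ t) (f : Lp ℝ 2 m) :
    IntervalIntegrable (fun s => E.semigroup s f) volume 0 t := by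
  rw [intervalIntegrable_iff_integrableOn_Ioc_of_le ht]
  have hmem : ∀ᵐ s ∂(volume.restrict (Set.Ioc 0 t)), s ∈ Set.Ioc 0 t :=
    ae_restrict_mem measurableSet_Ioc
  refine Integrable.mono' (g := fun _ => ‖f‖) (integrableOn_const (by simp)) ?_ ?_
  · refine aestronglyMeasurable_of_tendsto_ae (atTop : Filter ℝ)
      (f := fun γ s => E.yosidaSemigroup γ s f) (fun γ => ?_) ?_
    · have h : Continuous fun s => E.yosidaSemigroup γ s := exp_continuous_clm.comp (by fun_prop)
      exact (by fun_prop : Continuous fun s => E.yosidaSemigroup γ s f).aestronglyMeasurable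
    · filter_upwards [hmem] with s hs
      exact hE.tendsto_yosidaSemigroup hs.1.le f
  · filter_upwards [hmem] with s hs
    simpa using ContinuousLinearMap.le_of_opNorm_le _ (hE.norm_semigroup_le hs.1.le) f

/-- The Laplace formula for the resolvent, truncated at time `t`. For the Yosida semigroups it is
the fundamental theorem of calculus with `β u + A γ u` in place of `f`, and these vectors converge
to `f`. -/
theorem integral_exp_smul_semigroup (ht : 0 ≤ t) (hβ : 0 < β) (f : Lp ℝ 2 m) :
    ∫ s in (0 : ℝ)..t, Real.exp (-(β * s)) • E.semigroup s f
      = E.resolvent β f - Real.exp (-(β * t)) • E.semigroup t (E.resolvent β f) := by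
  set u := E.resolvent β f with hu
  let A : ℝ → Lp ℝ 2 m →L[ℝ] Lp ℝ 2 m := fun γ => γ • (1 - γ • E.resolvent γ)
  have hd : ∀ γ s : ℝ, HasDerivAt (fun s => -(Real.exp (-(β * s)) • E.yosidaSemigroup γ s u))
      (Real.exp (-(β * s)) • E.yosidaSemigroup γ s (β • u + A γ u)) s := by
    intro γ s
    have h1 : HasDerivAt (fun s : ℝ => Real.exp (-(β * s))) (Real.exp (-(β * s)) * -β) s := by
      simpa using (((hasDerivAt_id s).const_mul β).neg).exp
    have h2 : HasDerivAt (fun s : ℝ => E.yosidaSemigroup γ s u)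
        ((E.yosidaSemigroup γ s * -A γ) u) s := by
      have h3 := (ContinuousLinearMap.apply ℝ (Lp ℝ 2 m) u).hasFDerivAt.comp_hasDerivAt s
        (hasDerivAt_exp_smul_const (-A γ) s)
      have h4 : ∀ s, E.yosidaSemigroup γ s = NormedSpace.exp (s • -A γ) := fun s => by
        rw [yosidaSemigroup_eq, smul_neg, neg_smul]
      rw [funext fun s => congrArg (fun T : Lp ℝ 2 m →L[ℝ] Lp ℝ 2 m => T u) (h4 s), h4]
      exact h3
    refine (h1.smul h2).neg.congr_deriv ?_
    simp only [map_add, map_smul, mul_apply_eq_comp, neg_apply, map_neg]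
    module
  have hc : ∀ γ : ℝ, Continuous fun s =>
      Real.exp (-(β * s)) • E.yosidaSemigroup γ s (β • u + A γ u) := by
    intro γ
    have h1 : Continuous fun s => E.yosidaSemigroup γ s := exp_continuous_clm.comp (by fun_prop)
    fun_prop
  have hint : ∀ γ : ℝ, ∫ s in (0 : ℝ)..t,
      Real.exp (-(β * s)) • E.yosidaSemigroup γ s (β • u + A γ u)
      = u - Real.exp (-(β * t)) • E.yosidaSemigroup γ t u := by
    intro γ
    rw [intervalIntegral.integral_eq_sub_of_hasDerivAt (fun s _ => hd γ s)
      ((hc γ).intervalIntegrable _ _)]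
    simp only [mul_zero, neg_zero, Real.exp_zero, one_smul, yosidaSemigroup_zero,
      one_apply_eq_self]
    abel
  have hA : Tendsto (fun γ => β • u + A γ u) atTop (𝓝 f) := by
    have h := (hE.tendsto_yosida_resolvent hβ f).const_add (β • u)
    rwa [add_sub_cancel] at h
  refine tendsto_nhds_unique ?_
    (tendsto_const_nhds.sub ((hE.tendsto_yosidaSemigroup ht u).const_smul (Real.exp (-(β * t)))))
  simp only [← hint]
  -- The bound comes from `A γ u = γ K_γ (f - β u)` and contractivity of `γ K_γ`.
  refine intervalIntegral.tendsto_integral_filter_of_dominated_convergence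
    (fun _ => β * ‖u‖ + ‖f - β • u‖) ?_ ?_ ?_ ?_
  · exact Eventually.of_forall fun γ => (hc γ).aestronglyMeasurable
  · filter_upwards [eventually_gt_atTop 0] with γ hγ
    refine Eventually.of_forall fun s hs => ?_
    rw [Set.uIoc_of_le ht] at hs
    rw [norm_smul, Real.norm_of_nonneg (Real.exp_pos _).le]
    have h1 : Real.exp (-(β * s)) ≤ 1 :=
      Real.exp_le_one_iff.2 (neg_nonpos.2 (mul_nonneg hβ.le hs.1.le))
    refine (mul_le_of_le_one_left (norm_nonneg _) h1).trans ?_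
    refine (ContinuousLinearMap.le_of_opNorm_le _
      (hE.norm_yosidaSemigroup_le hγ hs.1.le) _).trans ?_
    rw [one_mul]
    refine (norm_add_le _ _).trans (add_le_add ?_ ?_)
    · rw [norm_smul, Real.norm_of_nonneg hβ.le]
    · rw [hu, hE.yosida_resolvent hβ hγ f]
      simpa using ContinuousLinearMap.le_of_opNorm_le _ (hE.norm_smul_resolvent_le hγ)
        (f - β • E.resolvent β f)
  · exact intervalIntegrable_const
  · refine Eventually.of_forall fun s hs => ?_
    rw [Set.uIoc_of_le ht] at hs
    exact (hE.tendsto_yosidaSemigroup_of_tendsto hs.1.le hA).const_smul _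

end FormOn.IsClosedForm

/-! ### Sub-Markovian operators. -/

/-- The `L²` functions with values in `[0,1]`. -/
def InUnit (f : Lp ℝ 2 m) : Prop := ∀ᵐ x ∂m, 0 ≤ f x ∧ f x ≤ 1

/-- As fixed points of a 1-Lipschitz map, these functions form a closed set, and truncation brings
no function farther from them. -/
theorem inUnit_iff {f : Lp ℝ 2 m} : InUnit f ↔ unitContraction f = f := by
  constructor
  · intro h
    refine Lp.ext ?_
    filter_upwards [h, coeFn_unitContraction f] with x hx h1
    rw [h1, max_eq_left hx.1, min_eq_left hx.2]
  · intro h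
    filter_upwards [coeFn_unitContraction f] with x h1
    rw [← h, h1]
    exact ⟨le_min (le_max_right _ _) zero_le_one, min_le_right _ _⟩

theorem lipschitzWith_unitContraction :
    LipschitzWith 1 (unitContraction : Lp ℝ 2 m → Lp ℝ 2 m) :=
  LipschitzWith.lipschitzWith_compLp ((LipschitzWith.id.max_const 0).min_const 1) (by simp)

theorem norm_unitContraction_sub_le (f g : Lp ℝ 2 m) :
    ‖unitContraction f - unitContraction g‖ ≤ ‖f - g‖ := by
  have h := lipschitzWith_unitContraction.dist_le_mul f g
  rwa [dist_eq_norm, dist_eq_norm, NNReal.coe_one, one_mul] at h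

theorem isClosed_setOf_inUnit : IsClosed {f : Lp ℝ 2 m | InUnit f} := by
  simp only [inUnit_iff]
  exact isClosed_eq lipschitzWith_unitContraction.continuous continuous_id

/-- Symmetric sub-Markovian operators on `L²`. -/
structure IsSubMarkovian (S : Lp ℝ 2 m →L[ℝ] Lp ℝ 2 m) : Prop where
  symm : ∀ f g, inner ℝ (S f) g = inner ℝ f (S g)
  inUnit : ∀ f, InUnit f → InUnit (S f)

theorem IsSubMarkovian.pow_inUnit {P : Lp ℝ 2 m →L[ℝ] Lp ℝ 2 m} (hP : IsSubMarkovian P) (n : ℕ)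
    {f : Lp ℝ 2 m} (hf : InUnit f) : InUnit ((P ^ n) f) := by
  induction n with
  | zero => simpa using hf
  | succ n ih =>
    rw [pow_succ', mul_apply_eq_comp]
    exact hP.inUnit _ ih

theorem IsSubMarkovian.pow {P : Lp ℝ 2 m →L[ℝ] Lp ℝ 2 m} (hP : IsSubMarkovian P) (n : ℕ) :
    IsSubMarkovian (P ^ n) := by
  refine ⟨?_, fun f hf => hP.pow_inUnit n hf⟩
  induction n with
  | zero => simp
  | succ n ih =>
    intro f g
    rw [pow_succ', mul_apply_eq_comp, hP.symm, ih, ← mul_apply_eq_comp, ← pow_succ, ← pow_succ']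

/-- Each partial sum of the Poisson mixture lies between `0` and the partial sum of the weights,
which is at most `1`. -/
theorem IsSubMarkovian.exp {P : Lp ℝ 2 m →L[ℝ] Lp ℝ 2 m} (hP : IsSubMarkovian P) {c : ℝ}
    (hc : 0 ≤ c) : IsSubMarkovian (NormedSpace.exp (-c • (1 - P))) := by
  refine ⟨inner_exp_neg_smul_one_sub hP.symm c, fun f hf => ?_⟩
  refine isClosed_setOf_inUnit.mem_of_tendsto
    (hasSum_exp_neg_smul_one_sub_apply c P f).tendsto_sum_nat (Eventually.of_forall fun N => ?_)
  have h : ∀ N : ℕ, ∀ᵐ x ∂m,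
      0 ≤ (∑ n ∈ Finset.range N, (Real.exp (-c) * (c ^ n / n.factorial)) • (P ^ n) f) x ∧
      (∑ n ∈ Finset.range N, (Real.exp (-c) * (c ^ n / n.factorial)) • (P ^ n) f) x
        ≤ ∑ n ∈ Finset.range N, Real.exp (-c) * (c ^ n / n.factorial) := by
    intro N
    induction N with
    | zero =>
      filter_upwards [Lp.coeFn_zero ℝ 2 m] with x hx
      rw [Finset.sum_range_zero, Finset.sum_range_zero, hx, Pi.zero_apply]
      exact ⟨le_rfl, le_rfl⟩
    | succ N ih =>
      simp only [Finset.sum_range_succ]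
      filter_upwards [ih, hP.pow_inUnit N hf,
        Lp.coeFn_add (∑ n ∈ Finset.range N, (Real.exp (-c) * (c ^ n / n.factorial)) • (P ^ n) f)
          ((Real.exp (-c) * (c ^ N / N.factorial)) • (P ^ N) f),
        Lp.coeFn_smul (Real.exp (-c) * (c ^ N / N.factorial)) ((P ^ N) f)] with x h1 h2 h3 h4
      rw [h3, Pi.add_apply, h4, Pi.smul_apply, smul_eq_mul]
      have hw := poisson_nonneg hc N
      exact ⟨add_nonneg h1.1 (mul_nonneg hw h2.1),
        add_le_add h1.2 (mul_le_of_le_one_right hw h2.2)⟩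
  filter_upwards [h N] with x hx
  exact ⟨hx.1, hx.2.trans (sum_le_hasSum _ (fun n _ => poisson_nonneg hc n) (hasSum_poisson c))⟩

/-- `u = β K_β f` minimizes `E[v] + β ‖v - f‖²`. Truncating `u` increases neither the energy nor the
distance to `f`, which is its own truncation; hence the truncation `v` equals `u`. The Euler
equation `heq` makes the uniqueness quantitative. -/
theorem FormOn.IsDirichletForm.isSubMarkovian_resolvent (hE : E.IsDirichletForm) {β : ℝ}
    (hβ : 0 < β) : IsSubMarkovian (β • E.resolvent β) := by
  have hc := hE.isClosedForm
  refine ⟨fun f g => ?_, fun f hf => ?_⟩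
  · rw [smul_apply, smul_apply, real_inner_smul_left, real_inner_smul_right, hc.resolvent_symm hβ]
  set u : E.dom := β • ⟨E.resolvent β f, hc.resolvent_mem hβ f⟩ with hu
  have hucoe : (β • E.resolvent β) f = (u : Lp ℝ 2 m) := rfl
  obtain ⟨hv, hle⟩ := hE.markov u
  set v : E.dom := ⟨unitContraction (u : Lp ℝ 2 m), hv⟩ with hvdef
  set w : E.dom := v - u with hw
  have hwcoe : (w : Lp ℝ 2 m) = unitContraction (u : Lp ℝ 2 m) - u := rfl
  have heq : E.form u w + β * inner ℝ ((u : Lp ℝ 2 m) - f) (w : Lp ℝ 2 m) = 0 := by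
    have h := hc.form_resolvent hβ f w
    rw [hu, map_smul, LinearMap.smul_apply, inner_sub_left, ← h]
    change _ + β * (inner ℝ (β • E.resolvent β f) (w : Lp ℝ 2 m) - _) = 0
    rw [real_inner_smul_left, smul_eq_mul]
    ring
  have hsum : E.form v v = E.form u u + 2 * E.form u w + E.form w w := by
    have hvw : v = u + w := by rw [hw, add_sub_cancel]
    rw [hvw, map_add, map_add, LinearMap.add_apply, LinearMap.add_apply, hE.symm w u]
    ring
  have hcontr : ‖(w : Lp ℝ 2 m) + ((u : Lp ℝ 2 m) - f)‖ ≤ ‖(u : Lp ℝ 2 m) - f‖ := by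
    have h := norm_unitContraction_sub_le (u : Lp ℝ 2 m) f
    rw [inUnit_iff.1 hf] at h
    rwa [hwcoe, sub_add_sub_cancel]
  have hsq : ‖(w : Lp ℝ 2 m)‖ ^ 2 + 2 * inner ℝ (w : Lp ℝ 2 m) ((u : Lp ℝ 2 m) - f) ≤ 0 := by
    have h1 := norm_add_sq_real (w : Lp ℝ 2 m) ((u : Lp ℝ 2 m) - f)
    have h2 := pow_le_pow_left₀ (norm_nonneg _) hcontr 2
    linarith
  rw [real_inner_comm] at hsq
  have hw0 : (w : Lp ℝ 2 m) = 0 := by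
    have h1 := hE.nonneg w
    have h2 : β * ‖(w : Lp ℝ 2 m)‖ ^ 2 ≤ 0 := by
      have := mul_le_mul_of_nonneg_left hsq hβ.le
      rw [mul_zero, mul_add] at this
      linarith
    have h3 : ‖(w : Lp ℝ 2 m)‖ ^ 2 ≤ 0 := nonpos_of_mul_nonpos_right h2 hβ
    exact norm_eq_zero.1 (pow_eq_zero_iff two_ne_zero |>.1 (le_antisymm h3 (sq_nonneg _)))
  rw [hucoe, inUnit_iff]
  rwa [hwcoe, sub_eq_zero] at hw0

theorem FormOn.IsDirichletForm.isSubMarkovian_semigroup (hE : E.IsDirichletForm) {t : ℝ}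
    (ht : 0 ≤ t) : IsSubMarkovian (E.semigroup t) := by
  refine ⟨hE.isClosedForm.semigroup_symm ht, fun f hf => ?_⟩
  refine isClosed_setOf_inUnit.mem_of_tendsto (hE.isClosedForm.tendsto_yosidaSemigroup ht f) ?_
  filter_upwards [eventually_gt_atTop 0] with γ hγ
  exact ((hE.isSubMarkovian_resolvent hγ).exp (mul_nonneg ht hγ.le)).inUnit f hf

/-! ### Mass and the extension to the constant `1`. -/

section Mass

theorem inner_eq_integral_mul (f g : Lp ℝ 2 m) : inner ℝ f g = ∫ x, f x * g x ∂m := by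
  rw [L2.inner_def]
  exact integral_congr_ae (Eventually.of_forall fun x => by simp [mul_comm])

theorem integrable_mul_coeFn (f g : Lp ℝ 2 m) : Integrable (fun x => f x * g x) m :=
  (L2.integrable_inner (𝕜 := ℝ) f g).congr (Eventually.of_forall fun x => by simp [mul_comm])

theorem IsExhaustion.inUnit {φ : ℕ → Lp ℝ 2 m} (hφ : IsExhaustion φ) (k : ℕ) : InUnit (φ k) := by
  filter_upwards [hφ.pos k, hφ.le_one k] with x h1 h2
  exact ⟨h1.le, h2⟩

theorem InUnit.inner_le_integral {f g : Lp ℝ 2 m} (hg : InUnit g) (hf : InUnit f)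
    (hi : Integrable f m) : inner ℝ g f ≤ ∫ x, f x ∂m := by
  rw [inner_eq_integral_mul]
  refine integral_mono_ae (integrable_mul_coeFn g f) hi ?_
  filter_upwards [hg, hf] with x h1 h2
  exact mul_le_of_le_one_left h2.1 h1.2

theorem IsExhaustion.tendsto_inner {φ : ℕ → Lp ℝ 2 m} (hφ : IsExhaustion φ) {f : Lp ℝ 2 m}
    (hi : Integrable f m) :
    Tendsto (fun k => inner ℝ (φ k) f) atTop (𝓝 (∫ x, f x ∂m)) := by
  simp only [inner_eq_integral_mul]
  refine tendsto_integral_of_dominated_convergence (fun x => ‖f x‖)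
    (fun k => (integrable_mul_coeFn _ _).aestronglyMeasurable) hi.norm (fun k => ?_) ?_
  · filter_upwards [hφ.inUnit k] with x hx
    rw [norm_mul, Real.norm_of_nonneg hx.1]
    exact mul_le_of_le_one_left (norm_nonneg _) hx.2
  · filter_upwards [hφ.tendsto] with x hx
    simpa using hx.mul_const (f x)

/-- Fatou's lemma along `φ k * f → f`. -/
theorem IsExhaustion.integrable_of_inner_le {φ : ℕ → Lp ℝ 2 m} (hφ : IsExhaustion φ)
    {f : Lp ℝ 2 m} (hf : InUnit f) {C : ℝ} (hC : ∀ k, inner ℝ (φ k) f ≤ C) : Integrable f m := by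
  refine ⟨(Lp.aestronglyMeasurable f), ?_⟩
  have h1 : ∫⁻ x, ‖f x‖ₑ ∂m ≤ liminf (fun k => ∫⁻ x, ‖φ k x * f x‖ₑ ∂m) atTop := by
    refine le_trans (lintegral_mono_ae ?_) (lintegral_liminf_le' fun k =>
      (integrable_mul_coeFn (φ k) f).aestronglyMeasurable.enorm)
    filter_upwards [hφ.tendsto] with x hx
    have h2 : Tendsto (fun k => ‖φ k x * f x‖ₑ) atTop (𝓝 ‖f x‖ₑ) := by
      simpa using (hx.mul_const (f x)).enorm
    exact h2.liminf_eq.ge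
  have h2 : ∀ k, ∫⁻ x, ‖φ k x * f x‖ₑ ∂m ≤ ENNReal.ofReal C := by
    intro k
    have h3 : 0 ≤ᵐ[m] fun x => φ k x * f x := by
      filter_upwards [hφ.inUnit k, hf] with x h4 h5
      exact mul_nonneg h4.1 h5.1
    rw [← ofReal_integral_norm_eq_lintegral_enorm (integrable_mul_coeFn (φ k) f)]
    refine ENNReal.ofReal_le_ofReal (le_trans (le_of_eq ?_) (hC k))
    rw [inner_eq_integral_mul]
    refine integral_congr_ae ?_
    filter_upwards [h3] with x hx
    exact Real.norm_of_nonneg hx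
  refine lt_of_le_of_lt (h1.trans ?_) (ENNReal.ofReal_lt_top (r := C))
  refine (liminf_le_liminf (Eventually.of_forall h2)).trans ?_
  simp

variable [SigmaFinite m] {S P : Lp ℝ 2 m →L[ℝ] Lp ℝ 2 m} {f : Lp ℝ 2 m}

/-- Symmetry moves `S` onto `φ_k`, and `0 ≤ S φ_k ≤ 1`. As the bound does not depend on `k`, it
yields both integrability of `S f` and the decrease of mass. -/
theorem IsSubMarkovian.inner_exhaustion_le (hS : IsSubMarkovian S) (hf : InUnit f)
    (hi : Integrable f m) (k : ℕ) : inner ℝ (exhaustion m k) (S f) ≤ ∫ x, f x ∂m := by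
  rw [← hS.symm]
  exact (hS.inUnit _ ((isExhaustion_exhaustion m).inUnit k)).inner_le_integral hf hi

theorem IsSubMarkovian.integrable (hS : IsSubMarkovian S) (hf : InUnit f) (hi : Integrable f m) :
    Integrable (S f) m :=
  (isExhaustion_exhaustion m).integrable_of_inner_le (hS.inUnit f hf)
    (hS.inner_exhaustion_le hf hi)

theorem IsSubMarkovian.integral_le (hS : IsSubMarkovian S) (hf : InUnit f) (hi : Integrable f m) :
    ∫ x, S f x ∂m ≤ ∫ x, f x ∂m :=
  le_of_tendsto' ((isExhaustion_exhaustion m).tendsto_inner (hS.integrable hf hi))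
    (hS.inner_exhaustion_le hf hi)

/-- The extension of a sub-Markovian operator to `L^∞`, evaluated at the constant `1`. -/
noncomputable def applyOne (S : Lp ℝ 2 m →L[ℝ] Lp ℝ 2 m) : X → ℝ :=
  fun x => limUnder atTop fun k : ℕ => S (exhaustion m k) x

/-- The increments `φ_{k+1} - φ_k` take values in `[0,1]`, so `S φ_k` is a.e. increasing and bounded
by `1`; hence `limUnder` is a genuine limit. -/
theorem IsSubMarkovian.tendsto_applyOne (hS : IsSubMarkovian S) :
    ∀ᵐ x ∂m, Tendsto (fun k => S (exhaustion m k) x) atTop (𝓝 (applyOne S x)) := by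
  have hφ := isExhaustion_exhaustion m
  have hmono : ∀ k, ∀ᵐ x ∂m, S (exhaustion m k) x ≤ S (exhaustion m (k + 1)) x := by
    intro k
    have hd : InUnit (exhaustion m (k + 1) - exhaustion m k) := by
      filter_upwards [hφ.inUnit k, hφ.inUnit (k + 1),
        (Lp.coeFn_le _ _).2 (hφ.mono (Nat.le_succ k)),
        Lp.coeFn_sub (exhaustion m (k + 1)) (exhaustion m k)] with x h1 h2 h3 h4
      rw [h4, Pi.sub_apply]
      exact ⟨sub_nonneg.2 h3, by linarith [h1.1, h2.2]⟩
    have h := hS.inUnit _ hd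
    rw [map_sub] at h
    filter_upwards [h, Lp.coeFn_sub (S (exhaustion m (k + 1))) (S (exhaustion m k))] with x h1 h2
    rw [h2, Pi.sub_apply] at h1
    exact sub_nonneg.1 h1.1
  filter_upwards [ae_all_iff.2 hmono, ae_all_iff.2 fun k => hS.inUnit _ (hφ.inUnit k)] with x h1 h2
  refine tendsto_nhds_limUnder ?_
  exact ⟨_, tendsto_atTop_ciSup (monotone_nat_of_le_succ h1) ⟨1, by
    rintro _ ⟨k, rfl⟩
    exact (h2 k).2⟩⟩

theorem IsSubMarkovian.applyOne_mem (hS : IsSubMarkovian S) :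
    ∀ᵐ x ∂m, 0 ≤ applyOne S x ∧ applyOne S x ≤ 1 := by
  filter_upwards [hS.tendsto_applyOne, ae_all_iff.2 fun k =>
    hS.inUnit _ ((isExhaustion_exhaustion m).inUnit k)] with x h1 h2
  exact ⟨ge_of_tendsto' h1 fun k => (h2 k).1, le_of_tendsto' h1 fun k => (h2 k).2⟩

theorem IsSubMarkovian.aestronglyMeasurable_applyOne (hS : IsSubMarkovian S) :
    AEStronglyMeasurable (applyOne S) m :=
  aestronglyMeasurable_of_tendsto_ae atTop (fun _ => Lp.aestronglyMeasurable _)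
    hS.tendsto_applyOne

theorem IsSubMarkovian.integrable_applyOne_mul (hS : IsSubMarkovian S) (hi : Integrable f m) :
    Integrable (fun x => applyOne S x * f x) m := by
  refine hi.norm.mono' (hS.aestronglyMeasurable_applyOne.mul hi.aestronglyMeasurable) ?_
  filter_upwards [hS.applyOne_mem] with x hx
  rw [norm_mul, Real.norm_of_nonneg hx.1]
  exact mul_le_of_le_one_left (norm_nonneg _) hx.2

theorem IsSubMarkovian.integral_applyOne_mul (hS : IsSubMarkovian S) (hf : InUnit f)
    (hi : Integrable f m) : ∫ x, applyOne S x * f x ∂m = ∫ x, S f x ∂m := by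
  have hφ := isExhaustion_exhaustion m
  refine tendsto_nhds_unique ?_ (hφ.tendsto_inner (hS.integrable hf hi))
  simp only [← hS.symm, inner_eq_integral_mul]
  refine tendsto_integral_of_dominated_convergence (fun x => ‖f x‖)
    (fun k => (integrable_mul_coeFn _ _).aestronglyMeasurable) hi.norm (fun k => ?_) ?_
  · filter_upwards [hS.inUnit _ (hφ.inUnit k)] with x hx
    rw [norm_mul, Real.norm_of_nonneg hx.1]
    exact mul_le_of_le_one_left (norm_nonneg _) hx.2
  · filter_upwards [hS.tendsto_applyOne] with x hx
    exact hx.mul_const (f x)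

/-- The integrable function `1_Y φ₀`, positive exactly on `Y`. -/
noncomputable def testFunction (m : Measure X) [SigmaFinite m] {Y : Set X}
    (hY : MeasurableSet Y) : Lp ℝ 2 m :=
  ((Lp.memLp (exhaustion m 0)).indicator hY).toLp _

theorem coeFn_testFunction {Y : Set X} (hY : MeasurableSet Y) :
    testFunction m hY =ᵐ[m] Y.indicator (exhaustion m 0) :=
  MemLp.coeFn_toLp _

theorem inUnit_testFunction {Y : Set X} (hY : MeasurableSet Y) : InUnit (testFunction m hY) := by
  filter_upwards [coeFn_testFunction hY, (isExhaustion_exhaustion m).inUnit 0] with x h1 h2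
  rw [h1]
  by_cases hx : x ∈ Y <;> simp [hx, h2.1, h2.2]

theorem integrable_testFunction {Y : Set X} (hY : MeasurableSet Y) :
    Integrable (testFunction m hY) m :=
  (((isExhaustion_exhaustion m).integrable 0).indicator hY).congr (coeFn_testFunction hY).symm

/-- The difference of the two masses is the integral of `(1 - S1) f ≥ 0`, where `f` is positive
exactly on `Y`. -/
theorem IsSubMarkovian.applyOne_eq_one_iff (hS : IsSubMarkovian S) {Y : Set X}
    (hY : MeasurableSet Y) :
    (∀ᵐ x ∂m, x ∈ Y → applyOne S x = 1) ↔
      ∫ x, S (testFunction m hY) x ∂m = ∫ x, testFunction m hY x ∂m := by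
  have hi := integrable_testFunction (m := m) hY
  have hoi := hS.integrable_applyOne_mul hi
  rw [← hS.integral_applyOne_mul (inUnit_testFunction hY) hi, eq_comm, ← sub_eq_zero,
    ← integral_sub' hi hoi, integral_eq_zero_iff_of_nonneg_ae ?_ (hi.sub hoi)]
  · refine eventually_congr ?_
    filter_upwards [coeFn_testFunction hY, (isExhaustion_exhaustion m).pos 0] with x h1 h2
    rw [Pi.sub_apply, h1]
    by_cases hx : x ∈ Y
    · simp only [hx, Set.indicator_of_mem, Pi.zero_apply, forall_const]
      constructor
      · intro h
        rw [h]
        ring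
      · intro h
        have h3 : (1 - applyOne S x) * exhaustion m 0 x = 0 := by linarith
        linarith [(mul_eq_zero.1 h3).resolve_right h2.ne']
    · simp [hx]
  · filter_upwards [hS.applyOne_mem, inUnit_testFunction (m := m) hY] with x h1 h2
    exact sub_nonneg.2 (mul_le_of_le_one_left h2.1 h1.2)

end Mass

/-! ### Semigroups of bounded forms. -/

section BoundedForm

variable {A : Lp ℝ 2 m →L[ℝ] Lp ℝ 2 m}

theorem isClosedForm_ofOperator (hsymm : ∀ f g, inner ℝ (A f) g = inner ℝ f (A g))
    (hnonneg : ∀ f, 0 ≤ inner ℝ (A f) f) : (FormOn.ofOperator A).IsClosedForm where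
  symm u v := by
    rw [FormOn.ofOperator_form, FormOn.ofOperator_form, hsymm, real_inner_comm]
  nonneg u := hnonneg u
  dense := dense_univ
  closed u hu := by
    have hc : CauchySeq fun j => (u j : Lp ℝ 2 m) := by
      refine Metric.cauchySeq_iff.2 fun ε hε => ?_
      obtain ⟨N, hN⟩ := hu (ε ^ 2) (by positivity)
      refine ⟨N, fun j hj k hk => ?_⟩
      rw [dist_eq_norm]
      refine lt_of_pow_lt_pow_left₀ 2 hε.le (lt_of_le_of_lt ?_ (hN j hj k hk))
      exact le_add_of_nonneg_left (hnonneg _)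
    obtain ⟨w, hw⟩ := cauchySeq_tendsto_of_complete hc
    refine ⟨⟨w, Submodule.mem_top⟩, ?_⟩
    have h0 : Tendsto (fun j => (u j : Lp ℝ 2 m) - w) atTop (𝓝 0) := by
      simpa using hw.sub_const w
    have h1 : Tendsto (fun j => inner ℝ (A ((u j : Lp ℝ 2 m) - w)) ((u j : Lp ℝ 2 m) - w)
        + ‖(u j : Lp ℝ 2 m) - w‖ ^ 2) atTop (𝓝 0) := by
      simpa using (((A.continuous.tendsto _).comp h0).inner h0).add (h0.norm.pow 2)
    exact h1

/-- For bounded `A` the Yosida generators converge in norm: `1 - γ K_γ = A K_γ` gives `γ (1 - γ K_γ)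
- A = -A A K_γ`, of norm at most `‖A‖² / γ`. -/
theorem semigroup_ofOperator (hsymm : ∀ f g, inner ℝ (A f) g = inner ℝ f (A g))
    (hnonneg : ∀ f, 0 ≤ inner ℝ (A f) f) {s : ℝ} (hs : 0 ≤ s) :
    (FormOn.ofOperator A).semigroup s = NormedSpace.exp (-s • A) := by
  have hF := isClosedForm_ofOperator hsymm hnonneg
  set F := FormOn.ofOperator A
  have hres : ∀ γ : ℝ, 0 < γ → 1 - γ • F.resolvent γ = A * F.resolvent γ := by
    intro γ hγ
    ext1 f
    refine ext_inner_right ℝ fun v => ?_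
    have h := hF.form_resolvent hγ f ⟨v, Submodule.mem_top⟩
    rw [FormOn.ofOperator_form] at h
    simp only [sub_apply, one_apply_eq_self, smul_apply, mul_apply_eq_comp, inner_sub_left,
      real_inner_smul_left]
    exact (eq_sub_of_add_eq h).symm
  have hlim : Tendsto (fun γ : ℝ => γ • (1 - γ • F.resolvent γ)) atTop (𝓝 A) := by
    rw [tendsto_iff_norm_sub_tendsto_zero]
    have h0 : Tendsto (fun γ : ℝ => ‖A‖ * ‖A‖ * γ⁻¹) atTop (𝓝 0) := by
      simpa using tendsto_inv_atTop_zero.const_mul (‖A‖ * ‖A‖)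
    refine squeeze_zero' (Eventually.of_forall fun _ => norm_nonneg _) ?_ h0
    filter_upwards [eventually_gt_atTop 0] with γ hγ
    have h1 : γ • (1 - γ • F.resolvent γ) - A = -(A * (A * F.resolvent γ)) := by
      rw [← hres γ hγ, mul_sub, mul_one, mul_smul_comm, ← hres γ hγ]
      abel
    rw [h1, norm_neg, mul_assoc]
    refine (norm_mul_le _ _).trans (mul_le_mul_of_nonneg_left ((norm_mul_le _ _).trans
      (mul_le_mul_of_nonneg_left ?_ (norm_nonneg _))) (norm_nonneg _))
    have h2 := hF.norm_smul_resolvent_le hγ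
    rw [norm_smul, Real.norm_of_nonneg hγ.le] at h2
    rwa [← one_div, le_div_iff₀' hγ]
  ext1 f
  refine tendsto_nhds_unique (hF.tendsto_yosidaSemigroup hs f) ?_
  simp only [FormOn.yosidaSemigroup_eq]
  exact ((ContinuousLinearMap.apply ℝ (Lp ℝ 2 m) f).continuous.tendsto _).comp
    ((exp_continuous_clm.tendsto _).comp (hlim.const_smul (-s)))

theorem IsSubMarkovian.semigroup_ofOperator {P : Lp ℝ 2 m →L[ℝ] Lp ℝ 2 m}
    (hP : IsSubMarkovian P) (hP1 : ‖P‖ ≤ 1) {c s : ℝ} (hc : 0 < c) (hs : 0 ≤ s) :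
    (FormOn.ofOperator (c • (1 - P))).semigroup s = NormedSpace.exp (-(s * c) • (1 - P)) := by
  rw [DirichletForms.semigroup_ofOperator _ _ hs, smul_smul, neg_mul]
  · intro f g
    simp only [smul_apply, sub_apply, one_apply_eq_self, real_inner_smul_left,
      real_inner_smul_right, inner_sub_left, inner_sub_right, hP.symm]
  · intro f
    simp only [smul_apply, sub_apply, one_apply_eq_self, real_inner_smul_left, inner_sub_left]
    refine mul_nonneg hc.le (sub_nonneg.2 ((real_inner_le_norm _ _).trans ?_))
    rw [real_inner_self_eq_norm_mul_norm]
    exact mul_le_mul_of_nonneg_right (by simpa using P.le_of_opNorm_le hP1 f) (norm_nonneg _)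

end BoundedForm

/-! ### Mass conservation for Poisson mixtures, semigroup and resolvent. -/

variable [SigmaFinite m] {P : Lp ℝ 2 m →L[ℝ] Lp ℝ 2 m} {f : Lp ℝ 2 m}

/-- Integration is in general not continuous on `L²`. The series is therefore paired with `φ_k`, and
`k → ∞` is justified by dominated convergence, since no `P ^ n` increases mass. -/
theorem IsSubMarkovian.hasSum_integral_exp (hP : IsSubMarkovian P) (hf : InUnit f)
    (hi : Integrable f m) {c : ℝ} (hc : 0 ≤ c) :
    HasSum (fun n : ℕ => Real.exp (-c) * (c ^ n / n.factorial) * ∫ x, (P ^ n) f x ∂m)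
      (∫ x, NormedSpace.exp (-c • (1 - P)) f x ∂m) := by
  have hφ := isExhaustion_exhaustion m
  have hpi : ∀ n, Integrable ((P ^ n) f) m := fun n => (hP.pow n).integrable hf hi
  have hk : ∀ k, HasSum (fun n : ℕ =>
      Real.exp (-c) * (c ^ n / n.factorial) * inner ℝ (exhaustion m k) ((P ^ n) f))
      (inner ℝ (exhaustion m k) (NormedSpace.exp (-c • (1 - P)) f)) := by
    intro k
    have h := (hasSum_exp_neg_smul_one_sub_apply c P f).mapL (innerSL ℝ (exhaustion m k))
    simpa only [innerSL_apply_apply, inner_smul_right] using h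
  have hnn : ∀ n, 0 ≤ ∫ x, (P ^ n) f x ∂m := fun n =>
    integral_nonneg_of_ae ((hP.pow_inUnit n hf).mono fun x hx => hx.1)
  have hsum : Summable fun n : ℕ => Real.exp (-c) * (c ^ n / n.factorial) * ∫ x, f x ∂m :=
    ((hasSum_poisson c).mul_right _).summable
  have hs : Summable fun n : ℕ =>
      Real.exp (-c) * (c ^ n / n.factorial) * ∫ x, (P ^ n) f x ∂m :=
    hsum.of_nonneg_of_le (fun n => mul_nonneg (poisson_nonneg hc n) (hnn n)) fun n =>
      mul_le_mul_of_nonneg_left ((hP.pow n).integral_le hf hi) (poisson_nonneg hc n)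
  have hlim := tendsto_tsum_of_dominated_convergence (𝓕 := atTop) hsum
    (fun n => (hφ.tendsto_inner (hpi n)).const_mul (Real.exp (-c) * (c ^ n / n.factorial)))
    (Eventually.of_forall fun k n => by
      rw [norm_mul, Real.norm_of_nonneg (poisson_nonneg hc n)]
      refine mul_le_mul_of_nonneg_left ?_ (poisson_nonneg hc n)
      rw [Real.norm_of_nonneg]
      · exact (hP.pow n).inner_exhaustion_le hf hi k
      · rw [inner_eq_integral_mul]
        refine integral_nonneg_of_ae ?_
        filter_upwards [hφ.inUnit k, hP.pow_inUnit n hf] with x h1 h2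
        exact mul_nonneg h1.1 h2.1)
  simp only [fun k => (hk k).tsum_eq] at hlim
  rw [tendsto_nhds_unique (hφ.tendsto_inner ((hP.exp hc).integrable hf hi)) hlim]
  exact hs.hasSum

/-- The mass lost by the mixture is the sum of the nonnegative losses of the `P ^ n` with strictly
positive weights. The criterion does not involve `c`, so for the approximating forms a single time
decides for all times. -/
theorem IsSubMarkovian.integral_exp_eq_iff (hP : IsSubMarkovian P) (hf : InUnit f)
    (hi : Integrable f m) {c : ℝ} (hc : 0 < c) :
    ∫ x, NormedSpace.exp (-c • (1 - P)) f x ∂m = ∫ x, f x ∂m ↔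
      ∀ n : ℕ, ∫ x, (P ^ n) f x ∂m = ∫ x, f x ∂m := by
  have h1 := ((hasSum_poisson c).mul_right (∫ x, f x ∂m)).sub (hP.hasSum_integral_exp hf hi hc.le)
  simp only [← mul_sub, one_mul] at h1
  rw [eq_comm, ← sub_eq_zero]
  constructor
  · intro h n
    rw [h, hasSum_zero_iff_of_nonneg] at h1
    · have h2 := congrFun h1 n
      have h3 := (mul_eq_zero.1 h2).resolve_left (poisson_pos hc n).ne'
      exact (sub_eq_zero.1 h3).symm
    · exact fun n => mul_nonneg (poisson_nonneg hc.le n)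
        (sub_nonneg.2 ((hP.pow n).integral_le hf hi))
  · intro h
    refine h1.unique ?_
    simp only [h, sub_self, mul_zero]
    exact hasSum_zero

theorem IsSubMarkovian.semigroup_ofOperator_conserves_iff (hP : IsSubMarkovian P) (hP1 : ‖P‖ ≤ 1)
    {c : ℝ} (hc : 0 < c) (hf : InUnit f) (hi : Integrable f m) :
    (∀ s : ℝ, 0 < s →
      ∫ x, (FormOn.ofOperator (c • (1 - P))).semigroup s f x ∂m = ∫ x, f x ∂m) ↔
      ∀ n : ℕ, ∫ x, (P ^ n) f x ∂m = ∫ x, f x ∂m := by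
  constructor
  · intro h
    have h1 := h 1 one_pos
    rw [hP.semigroup_ofOperator hP1 hc zero_le_one] at h1
    exact (hP.integral_exp_eq_iff hf hi (by positivity)).1 h1
  · intro h s hs
    rw [hP.semigroup_ofOperator hP1 hc hs.le]
    exact (hP.integral_exp_eq_iff hf hi (by positivity)).2 h

namespace FormOn.IsDirichletForm

variable (hE : E.IsDirichletForm) {β t s : ℝ}
include hE

theorem integral_semigroup_antitone (hf : InUnit f) (hi : Integrable f m) (hs : 0 ≤ s)
    (hst : s ≤ t) : ∫ x, E.semigroup t f x ∂m ≤ ∫ x, E.semigroup s f x ∂m := by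
  have hS := hE.isSubMarkovian_semigroup hs
  have h : E.semigroup t = E.semigroup (t - s) * E.semigroup s := by
    rw [← hE.isClosedForm.semigroup_add (sub_nonneg.2 hst) hs, sub_add_cancel]
  rw [h]
  exact (hE.isSubMarkovian_semigroup (sub_nonneg.2 hst)).integral_le (hS.inUnit f hf)
    (hS.integrable hf hi)

omit [SigmaFinite m] in
theorem semigroup_natCast_mul (ht : 0 ≤ t) (n : ℕ) :
    E.semigroup (n * t) = E.semigroup t ^ n := by
  induction n with
  | zero => simp [hE.isClosedForm.semigroup_zero]
  | succ n ih =>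
    rw [pow_succ, ← ih, ← hE.isClosedForm.semigroup_add (by positivity) ht]
    congr 1
    push_cast
    ring

theorem semigroup_pow_conserves_iff (ht : 0 < t) (hf : InUnit f) (hi : Integrable f m) :
    (∀ n : ℕ, ∫ x, (E.semigroup t ^ n) f x ∂m = ∫ x, f x ∂m) ↔
      ∀ s : ℝ, 0 < s → ∫ x, E.semigroup s f x ∂m = ∫ x, f x ∂m := by
  constructor
  · intro h s hs
    refine le_antisymm ((hE.isSubMarkovian_semigroup hs.le).integral_le hf hi) ?_
    -- Mass at time `s` lies between the initial mass and the mass at the later time `n * t`.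
    obtain ⟨n, hn⟩ := exists_nat_ge (s / t)
    rw [← h n, ← hE.semigroup_natCast_mul ht.le]
    exact hE.integral_semigroup_antitone hf hi hs.le ((div_le_iff₀ ht).1 hn)
  · intro h n
    rcases n.eq_zero_or_pos with rfl | hn
    · simp
    · rw [← hE.semigroup_natCast_mul ht.le]
      exact h _ (by positivity)

omit [SigmaFinite m] in
theorem integral_inner_semigroup (ht : 0 ≤ t) (hβ : 0 < β) (g f : Lp ℝ 2 m) :
    ∫ s in (0 : ℝ)..t, β * Real.exp (-(β * s)) * inner ℝ g (E.semigroup s f)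
      = inner ℝ g ((β • E.resolvent β) f)
        - Real.exp (-(β * t)) * inner ℝ g (E.semigroup t ((β • E.resolvent β) f)) := by
  have hint := (hE.isClosedForm.intervalIntegrable_semigroup ht f).continuousOn_smul
    (f := fun s => Real.exp (-(β * s))) (by fun_prop)
  have h := congrArg (fun u => β * innerSL ℝ g u)
    (hE.isClosedForm.integral_exp_smul_semigroup ht hβ f)
  simp only [← ContinuousLinearMap.intervalIntegral_comp_comm _ hint,
    ← intervalIntegral.integral_const_mul] at h
  simp only [innerSL_apply_apply, inner_smul_right, inner_sub_right] at h
  simp only [smul_apply, map_smul, inner_smul_right, mul_assoc]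
  rw [h]
  ring

omit [SigmaFinite m] in
theorem intervalIntegrable_inner_semigroup (ht : 0 ≤ t) (g f : Lp ℝ 2 m) :
    IntervalIntegrable (fun s => β * Real.exp (-(β * s)) * inner ℝ g (E.semigroup s f))
      volume 0 t := by
  have h := hE.isClosedForm.intervalIntegrable_semigroup ht f
  have h1 : IntervalIntegrable (fun s => inner ℝ g (E.semigroup s f)) volume 0 t :=
    ⟨(innerSL ℝ g).integrable_comp h.1, (innerSL ℝ g).integrable_comp h.2⟩
  exact h1.continuousOn_mul (by fun_prop)

omit hE [SigmaFinite m] in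
theorem _root_.DirichletForms.integral_mul_exp_neg (β t : ℝ) :
    ∫ s in (0 : ℝ)..t, β * Real.exp (-(β * s)) = 1 - Real.exp (-(β * t)) := by
  have hd : ∀ s : ℝ, HasDerivAt (fun s => -Real.exp (-(β * s))) (β * Real.exp (-(β * s))) s := by
    intro s
    have h1 : HasDerivAt (fun s : ℝ => Real.exp (-(β * s))) (Real.exp (-(β * s)) * -β) s := by
      simpa using (((hasDerivAt_id s).const_mul β).neg).exp
    refine h1.neg.congr_deriv ?_
    ring
  rw [intervalIntegral.integral_eq_sub_of_hasDerivAt (fun s _ => hd s)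
    ((by fun_prop : Continuous fun s => β * Real.exp (-(β * s))).intervalIntegrable _ _)]
  simp only [mul_zero, neg_zero, Real.exp_zero]
  ring

/-- With `p = β K_β f`, split `p = ∫₀ᵗ β e^{-βs} T_s f ds + e^{-βt} T_t p`. The integral has mass at
most `(1 - e^{-βt}) ∫ f`, so if `p` has full mass then so has `T_t p`. Since `T_t p = β K_β T_t f`,
the mass of `T_t f` is at least as large. -/
theorem semigroup_conserves_of_resolvent (hβ : 0 < β) (hf : InUnit f) (hi : Integrable f m)
    (h : ∫ x, (β • E.resolvent β) f x ∂m = ∫ x, f x ∂m) (ht : 0 < t) :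
    ∫ x, E.semigroup t f x ∂m = ∫ x, f x ∂m := by
  have hφ := isExhaustion_exhaustion m
  have hK := hE.isSubMarkovian_resolvent hβ
  have hT := hE.isSubMarkovian_semigroup ht.le
  set p := (β • E.resolvent β) f with hp
  have hpU : InUnit p := hK.inUnit f hf
  have hpi : Integrable p m := hK.integrable hf hi
  refine le_antisymm (hT.integral_le hf hi) ?_
  have hcomm : E.semigroup t p = (β • E.resolvent β) (E.semigroup t f) := by
    rw [hp, smul_apply, smul_apply, map_smul, hE.isClosedForm.semigroup_resolvent_comm ht.le hβ]
  have h1 : ∫ x, E.semigroup t p x ∂m ≤ ∫ x, E.semigroup t f x ∂m := by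
    rw [hcomm]
    exact hK.integral_le (hT.inUnit f hf) (hT.integrable hf hi)
  have h2 : ∀ k, inner ℝ (exhaustion m k) p
      - Real.exp (-(β * t)) * inner ℝ (exhaustion m k) (E.semigroup t p)
      ≤ (1 - Real.exp (-(β * t))) * ∫ x, f x ∂m := by
    intro k
    rw [← hE.integral_inner_semigroup ht.le hβ, ← integral_mul_exp_neg,
      ← intervalIntegral.integral_mul_const]
    refine intervalIntegral.integral_mono_on ht.le
      (hE.intervalIntegrable_inner_semigroup ht.le _ _)
      (Continuous.intervalIntegrable (by fun_prop) _ _) fun s hs => ?_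
    exact mul_le_mul_of_nonneg_left
      ((hE.isSubMarkovian_semigroup hs.1).inner_exhaustion_le hf hi k) (by positivity)
  have h3 := le_of_tendsto' ((hφ.tendsto_inner hpi).sub
    ((hφ.tendsto_inner (hT.integrable hpU hpi)).const_mul (Real.exp (-(β * t))))) h2
  rw [h] at h3
  have h4 : Real.exp (-(β * t)) * ∫ x, f x ∂m
      ≤ Real.exp (-(β * t)) * ∫ x, E.semigroup t p x ∂m := by linarith
  exact (le_of_mul_le_mul_left h4 (Real.exp_pos _)).trans h1

theorem resolvent_conserves_of_semigroup (hβ : 0 < β) (hf : InUnit f) (hi : Integrable f m)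
    (h : ∀ s : ℝ, 0 < s → ∫ x, E.semigroup s f x ∂m = ∫ x, f x ∂m) :
    ∫ x, (β • E.resolvent β) f x ∂m = ∫ x, f x ∂m := by
  have hφ := isExhaustion_exhaustion m
  have hK := hE.isSubMarkovian_resolvent hβ
  set p := (β • E.resolvent β) f with hp
  have hpU : InUnit p := hK.inUnit f hf
  have hpi : Integrable p m := hK.integrable hf hi
  refine le_antisymm (hK.integral_le hf hi) ?_
  have hnn : ∀ k {u : Lp ℝ 2 m}, InUnit u → 0 ≤ inner ℝ (exhaustion m k) u := by
    intro k u hu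
    rw [inner_eq_integral_mul]
    refine integral_nonneg_of_ae ?_
    filter_upwards [hφ.inUnit k, hu] with x h1 h2
    exact mul_nonneg h1.1 h2.1
  -- Drop the nonnegative term at time `t` in the truncated Laplace formula; the remaining loss
  -- `e^{-βt}` vanishes as `t → ∞`.
  have h1 : ∀ t : ℝ, 0 < t → (1 - Real.exp (-(β * t))) * ∫ x, f x ∂m ≤ ∫ x, p x ∂m := by
    intro t ht
    have hT := hE.isSubMarkovian_semigroup ht.le
    have hlim : Tendsto (fun k => ∫ s in (0 : ℝ)..t,
        β * Real.exp (-(β * s)) * inner ℝ (exhaustion m k) (E.semigroup s f)) atTop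
        (𝓝 (∫ s in (0 : ℝ)..t, β * Real.exp (-(β * s)) * ∫ x, f x ∂m)) := by
      refine intervalIntegral.tendsto_integral_filter_of_dominated_convergence
        (fun s => β * Real.exp (-(β * s)) * ∫ x, f x ∂m) ?_ ?_ ?_ ?_
      · refine Eventually.of_forall fun k => ?_
        rw [Set.uIoc_of_le ht.le]
        exact (hE.intervalIntegrable_inner_semigroup ht.le _ _).1.aestronglyMeasurable
      · refine Eventually.of_forall fun k => Eventually.of_forall fun s hs => ?_
        rw [Set.uIoc_of_le ht.le] at hs
        have hS := hE.isSubMarkovian_semigroup hs.1.le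
        rw [Real.norm_of_nonneg (mul_nonneg (by positivity) (hnn k (hS.inUnit f hf)))]
        exact mul_le_mul_of_nonneg_left (hS.inner_exhaustion_le hf hi k) (by positivity)
      · exact Continuous.intervalIntegrable (by fun_prop) _ _
      · refine Eventually.of_forall fun s hs => ?_
        rw [Set.uIoc_of_le ht.le] at hs
        have hS := hE.isSubMarkovian_semigroup hs.1.le
        have h2 := hφ.tendsto_inner (hS.integrable hf hi)
        rw [h s hs.1] at h2
        exact h2.const_mul _
    rw [intervalIntegral.integral_mul_const, integral_mul_exp_neg] at hlim
    refine le_of_tendsto_of_tendsto' hlim (hφ.tendsto_inner hpi) fun k => ?_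
    rw [hE.integral_inner_semigroup ht.le hβ]
    exact sub_le_self _ (mul_nonneg (Real.exp_pos _).le (hnn k (hT.inUnit p hpU)))
  have h2 : Tendsto (fun t : ℝ => (1 - Real.exp (-(β * t))) * ∫ x, f x ∂m) atTop
      (𝓝 ((1 - 0) * ∫ x, f x ∂m)) := by
    refine (Tendsto.const_sub _ ?_).mul_const _
    exact Real.tendsto_exp_neg_atTop_nhds_zero.comp (tendsto_id.const_mul_atTop hβ)
  rw [sub_zero, one_mul] at h2
  refine le_of_tendsto h2 ?_
  filter_upwards [eventually_gt_atTop 0] with t ht using h1 t ht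

theorem resolvent_pow_conserves_iff (hβ : 0 < β) (hf : InUnit f) (hi : Integrable f m) :
    (∀ n : ℕ, ∫ x, ((β • E.resolvent β) ^ n) f x ∂m = ∫ x, f x ∂m) ↔
      ∀ s : ℝ, 0 < s → ∫ x, E.semigroup s f x ∂m = ∫ x, f x ∂m := by
  constructor
  · intro h s hs
    refine hE.semigroup_conserves_of_resolvent hβ hf hi ?_ hs
    simpa only [pow_one] using h 1
  · intro h n
    have hK := hE.isSubMarkovian_resolvent hβ
    -- The hypothesis passes from `f` to `β K_β f`: the operators commute, and by the semigroup law
    -- `T_s f` satisfies it as well.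
    induction n generalizing f with
    | zero => simp
    | succ n ih =>
      rw [pow_succ, mul_apply_eq_comp, ih (hK.inUnit f hf) (hK.integrable hf hi),
        hE.resolvent_conserves_of_semigroup hβ hf hi h]
      intro s hs
      have hS := hE.isSubMarkovian_semigroup hs.le
      have hcomm : E.semigroup s ((β • E.resolvent β) f)
          = (β • E.resolvent β) (E.semigroup s f) := by
        rw [smul_apply, smul_apply, map_smul, hE.isClosedForm.semigroup_resolvent_comm hs.le hβ]
      rw [hcomm, hE.resolvent_conserves_of_semigroup hβ hf hi h,
        hE.resolvent_conserves_of_semigroup hβ (hS.inUnit f hf) (hS.integrable hf hi), h s hs]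
      intro r hr
      rw [← mul_apply_eq_comp, ← hE.isClosedForm.semigroup_add hr.le hs.le, h s hs,
        h _ (add_pos hr hs)]

end FormOn.IsDirichletForm

/-! ### Conservative and dissipative spaces. -/

/-- `T_t 1 = 1` almost everywhere on `Z`, for every `t > 0`. -/
def FormOn.OneOn (E : FormOn m) (Z : Set X) : Prop :=
  ∀ t : ℝ, 0 < t → ∀ᵐ x ∂m, x ∈ Z → E.semigroupOne t x = 1

theorem FormOn.oneOn_iff {F : FormOn m} (hF : ∀ t : ℝ, 0 < t → IsSubMarkovian (F.semigroup t))
    {Z : Set X} (hZ : MeasurableSet Z) :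
    F.OneOn Z ↔ ∀ t : ℝ, 0 < t →
      ∫ x, F.semigroup t (testFunction m hZ) x ∂m = ∫ x, testFunction m hZ x ∂m :=
  -- `F.semigroupOne t` unfolds to `applyOne (F.semigroup t)`.
  forall₂_congr fun t ht => (hF t ht).applyOne_eq_one_iff hZ

theorem FormOn.isConservativeSpace_congr {F G : FormOn m}
    (h : ∀ Z : Set X, MeasurableSet Z → (F.OneOn Z ↔ G.OneOn Z)) (Y : Set X) :
    F.IsConservativeSpace Y ↔ G.IsConservativeSpace Y :=
  ⟨fun hY => ⟨hY.measurableSet, (h Y hY.measurableSet).1 hY.eq_one,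
      fun Z hZ h1 => hY.greatest Z hZ ((h Z hZ).2 h1)⟩,
    fun hY => ⟨hY.measurableSet, (h Y hY.measurableSet).2 hY.eq_one,
      fun Z hZ h1 => hY.greatest Z hZ ((h Z hZ).1 h1)⟩⟩

theorem FormOn.isConservative_iff_oneOn {F : FormOn m} :
    F.IsConservative ↔ F.OneOn Set.univ := by
  simp [FormOn.IsConservative, FormOn.OneOn]

/-- Since `T_t 1 ≤ 1` a.e., failure of `T_t 1 = 1` a.e. means `T_t 1 < 1` on a set of positive
measure. -/
theorem FormOn.isDissipative_iff {F : FormOn m}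
    (hF : ∀ t : ℝ, 0 < t → IsSubMarkovian (F.semigroup t)) :
    F.IsDissipative ↔ ¬ F.IsConservative := by
  simp only [FormOn.IsDissipative, FormOn.IsConservative, not_forall, exists_prop]
  refine exists_congr fun t => and_congr_right fun ht => ?_
  rw [pos_iff_ne_zero, ne_eq, not_iff_not, measure_eq_zero_iff_ae_notMem]
  refine eventually_congr ?_
  filter_upwards [(hF t ht).applyOne_mem] with x hx
  exact ⟨fun h => le_antisymm hx.2 (not_lt.1 h), fun h => not_lt.2 h.ge⟩

namespace FormOn.IsDirichletForm

variable (hE : E.IsDirichletForm)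
include hE

omit [SigmaFinite m] in
theorem isSubMarkovian_semigroup_timeApprox {t : ℝ} (ht : 0 < t) (s : ℝ) (hs : 0 < s) :
    IsSubMarkovian ((E.timeApprox t).semigroup s) := by
  have hP := hE.isSubMarkovian_semigroup ht.le
  rw [FormOn.timeApprox, hP.semigroup_ofOperator (hE.isClosedForm.norm_semigroup_le ht.le)
    (inv_pos.2 ht) hs.le]
  exact hP.exp (by positivity)

omit [SigmaFinite m] in
theorem isSubMarkovian_semigroup_denyYosida {β : ℝ} (hβ : 0 < β) (s : ℝ) (hs : 0 < s) :
    IsSubMarkovian ((E.denyYosida β).semigroup s) := by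
  have hP := hE.isSubMarkovian_resolvent hβ
  rw [FormOn.denyYosida, hP.semigroup_ofOperator (hE.isClosedForm.norm_smul_resolvent_le hβ)
    hβ hs.le]
  exact hP.exp (by positivity)

theorem oneOn_timeApprox_iff {t : ℝ} (ht : 0 < t) (Z : Set X) (hZ : MeasurableSet Z) :
    (E.timeApprox t).OneOn Z ↔ E.OneOn Z := by
  rw [FormOn.oneOn_iff (hE.isSubMarkovian_semigroup_timeApprox ht) hZ,
    FormOn.oneOn_iff (fun s hs => hE.isSubMarkovian_semigroup hs.le) hZ,
    ← hE.semigroup_pow_conserves_iff ht (inUnit_testFunction hZ) (integrable_testFunction hZ)]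
  exact (hE.isSubMarkovian_semigroup ht.le).semigroup_ofOperator_conserves_iff
    (hE.isClosedForm.norm_semigroup_le ht.le) (inv_pos.2 ht) (inUnit_testFunction hZ)
    (integrable_testFunction hZ)

theorem oneOn_denyYosida_iff {β : ℝ} (hβ : 0 < β) (Z : Set X) (hZ : MeasurableSet Z) :
    (E.denyYosida β).OneOn Z ↔ E.OneOn Z := by
  rw [FormOn.oneOn_iff (hE.isSubMarkovian_semigroup_denyYosida hβ) hZ,
    FormOn.oneOn_iff (fun s hs => hE.isSubMarkovian_semigroup hs.le) hZ,
    ← hE.resolvent_pow_conserves_iff hβ (inUnit_testFunction hZ) (integrable_testFunction hZ)]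
  exact (hE.isSubMarkovian_resolvent hβ).semigroup_ofOperator_conserves_iff
    (hE.isClosedForm.norm_smul_resolvent_le hβ) hβ (inUnit_testFunction hZ)
    (integrable_testFunction hZ)

theorem exists_isConservativeSpace : ∃ Y : Set X, E.IsConservativeSpace Y := by
  have hT : ∀ t : ℝ, 0 < t → IsSubMarkovian (E.semigroup t) := fun t ht =>
    hE.isSubMarkovian_semigroup ht.le
  have hpos : ∀ n : ℕ, (0 : ℝ) < n + 1 := fun n => by positivity
  have hmeas : ∀ n : ℕ, AEStronglyMeasurable (E.semigroupOne (n + 1)) m := fun n =>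
    (hT _ (hpos n)).aestronglyMeasurable_applyOne
  -- The positive integer times suffice because mass decreases in time: a test function keeping its
  -- mass up to time `n + 1 ≥ t` keeps it at time `t`.
  let Y : Set X := ⋂ n : ℕ, {x | (hmeas n).mk _ x = 1}
  have hY : MeasurableSet Y := MeasurableSet.iInter fun n =>
    (hmeas n).stronglyMeasurable_mk.measurable (measurableSet_singleton 1)
  have hnat : ∀ n : ℕ, ∀ᵐ x ∂m, x ∈ Y → E.semigroupOne (n + 1) x = 1 := by
    intro n
    filter_upwards [(hmeas n).ae_eq_mk] with x hx hxY
    rw [hx]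
    exact Set.mem_iInter.1 hxY n
  refine ⟨Y, hY, ?_, fun Z hZ h1 => ?_⟩
  · refine (FormOn.oneOn_iff hT hY).2 fun t ht => ?_
    have hU := inUnit_testFunction (m := m) hY
    have hi := integrable_testFunction (m := m) hY
    refine le_antisymm ((hT t ht).integral_le hU hi) ?_
    obtain ⟨n, hn⟩ := exists_nat_ge t
    rw [← ((hT _ (hpos n)).applyOne_eq_one_iff hY).1 (hnat n)]
    exact hE.integral_semigroup_antitone hU hi ht.le (by linarith)
  · filter_upwards [ae_all_iff.2 fun n : ℕ => h1 _ (hpos n),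
      ae_all_iff.2 fun n : ℕ => (hmeas n).ae_eq_mk] with x h2 h3 hx
    refine Set.mem_iInter.2 fun n => ?_
    rw [Set.mem_ofPred_eq, ← h3 n]
    exact h2 n hx

end FormOn.IsDirichletForm

end DirichletForms

theorem mainTheorem6 {X : Type*} [MeasurableSpace X] (m : MeasureTheory.Measure X)
    [MeasureTheory.SigmaFinite m] (E : DirichletForms.FormOn m) (hE : E.IsDirichletForm) :
    -- the conservative and the dissipative space of `E` exist
    (∃ Y : Set X, E.IsConservativeSpace Y ∧ E.IsDissipativeSpace Yᶜ) ∧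
    -- equality, up to null sets, of the conservative and of the dissipative spaces
    (∀ t : ℝ, 0 < t → ∀ β : ℝ, 0 < β → ∀ Y : Set X,
      ((E.timeApprox t).IsConservativeSpace Y ↔ E.IsConservativeSpace Y) ∧
      ((E.denyYosida β).IsConservativeSpace Y ↔ E.IsConservativeSpace Y) ∧
      ((E.timeApprox t).IsDissipativeSpace Y ↔ E.IsDissipativeSpace Y) ∧
      ((E.denyYosida β).IsDissipativeSpace Y ↔ E.IsDissipativeSpace Y)) ∧
    -- conservativeness
    List.TFAE [E.IsConservative,
      ∃ t : ℝ, 0 < t ∧ (E.timeApprox t).IsConservative,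
      ∀ t : ℝ, 0 < t → (E.timeApprox t).IsConservative,
      ∃ β : ℝ, 0 < β ∧ (E.denyYosida β).IsConservative,
      ∀ β : ℝ, 0 < β → (E.denyYosida β).IsConservative] ∧
    -- dissipativity
    List.TFAE [E.IsDissipative,
      ∃ t : ℝ, 0 < t ∧ (E.timeApprox t).IsDissipative,
      ∀ t : ℝ, 0 < t → (E.timeApprox t).IsDissipative,
      ∃ β : ℝ, 0 < β ∧ (E.denyYosida β).IsDissipative,
      ∀ β : ℝ, 0 < β → (E.denyYosida β).IsDissipative] := by
  have ht : ∀ t : ℝ, 0 < t → ((E.timeApprox t).IsConservative ↔ E.IsConservative) := fun t h => by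
    rw [DirichletForms.FormOn.isConservative_iff_oneOn,
      hE.oneOn_timeApprox_iff h _ MeasurableSet.univ,
      DirichletForms.FormOn.isConservative_iff_oneOn]
  have hβ : ∀ β : ℝ, 0 < β → ((E.denyYosida β).IsConservative ↔ E.IsConservative) := fun β h => by
    rw [DirichletForms.FormOn.isConservative_iff_oneOn,
      hE.oneOn_denyYosida_iff h _ MeasurableSet.univ,
      DirichletForms.FormOn.isConservative_iff_oneOn]
  have hd := DirichletForms.FormOn.isDissipative_iff fun s hs =>
    hE.isSubMarkovian_semigroup (t := s) hs.le
  have htd : ∀ t : ℝ, 0 < t → ((E.timeApprox t).IsDissipative ↔ E.IsDissipative) := fun t h => by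
    rw [DirichletForms.FormOn.isDissipative_iff (hE.isSubMarkovian_semigroup_timeApprox h), hd,
      ht t h]
  have hβd : ∀ β : ℝ, 0 < β → ((E.denyYosida β).IsDissipative ↔ E.IsDissipative) := fun β h => by
    rw [DirichletForms.FormOn.isDissipative_iff (hE.isSubMarkovian_semigroup_denyYosida h), hd,
      hβ β h]
  -- Both chains have the same shape: the property of an approximation at each single parameter is
  -- equivalent to that of `E`.
  have tfae : ∀ {p : Prop} {q r : ℝ → Prop}, (∀ t : ℝ, 0 < t → (q t ↔ p)) →
      (∀ t : ℝ, 0 < t → (r t ↔ p)) → List.TFAE [p, ∃ t : ℝ, 0 < t ∧ q t, ∀ t : ℝ, 0 < t → q t,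
        ∃ t : ℝ, 0 < t ∧ r t, ∀ t : ℝ, 0 < t → r t] := by
    intro p q r hq hr
    tfae_have 1 → 3 := fun h t ht => (hq t ht).2 h
    tfae_have 3 → 2 := fun h => ⟨1, one_pos, h 1 one_pos⟩
    tfae_have 2 → 1 := fun ⟨t, ht, h⟩ => (hq t ht).1 h
    tfae_have 1 → 5 := fun h t ht => (hr t ht).2 h
    tfae_have 5 → 4 := fun h => ⟨1, one_pos, h 1 one_pos⟩
    tfae_have 4 → 1 := fun ⟨t, ht, h⟩ => (hr t ht).1 h
    tfae_finish
  refine ⟨?_, fun t h β h' Y => ?_, tfae ht hβ, tfae htd hβd⟩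
  · obtain ⟨Y, hY⟩ := hE.exists_isConservativeSpace
    refine ⟨Y, hY, ?_⟩
    rwa [DirichletForms.FormOn.IsDissipativeSpace, compl_compl]
  · have h1 := DirichletForms.FormOn.isConservativeSpace_congr (hE.oneOn_timeApprox_iff h)
    have h2 := DirichletForms.FormOn.isConservativeSpace_congr (hE.oneOn_denyYosida_iff h')
    exact ⟨h1 Y, h2 Y, h1 Yᶜ, h2 Yᶜ⟩
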